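/- Conventions. For a matroid $M$ on $[m]=\{1,\dots,m\}$ let $\mathcal P(M)=\mathrm{conv}\{e_B : B \text{ a basis of } M\}\subset\mathbb R^m$. For $S\subseteq[m]$ the Schubert matroid $\mathrm{SM}_m(S)$ is the matroid on $[m]$ whose bases are the sets $T$ with $|T|=|S|$ such that, for every $i$, the $i$-th smallest element of $T$ is at most the $i$-th smallest element of $S$. A labeled Schubert matroid of rank $k$ on $[m]$ is any matroid on $[m]$ isomorphic to some $\mathrm{SM}_m(S)$ with $|S|=k$. The indicator function of the polytope of a rank $k$ matroid $M$ on $[m]$ has a unique expansion $\mathbf 1_{\mathcal P(M)}=\sum_{N} c_{N}\,\mathbf 1_{\mathcal P(N)}$ with integers $c_N$, the sum being over the labeled Schubert matroids $N$ of rank $k$ on $[m]$; put $p_M=(c_N)_N$. Let $p_{[M]}$ be the vector indexed by the isomorphism classes of Schubert matroids of rank $k$ on $m$ elements that is obtained from $p_M$ by adding up the coordinates of isomorphic Schubert matroids. The polytope of all matroids $\Omega_{k,m}$ is the convex hull of the points $p_{[M]}$ over all matroids $M$ of rank $k$ on $[m]$, and $M$ is called extremal if $p_{[M]}$ is a vertex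 of $\Omega_{k,m}$. The Catalan matroid is $C_n=\mathrm{SM}_{2n}(\{2,4,\dots,2n\})$. For a partition $\lambda=(\lambda_1,\dots,\lambda_\ell)$ of $n$ let $U_\lambda=\bigoplus_{i=1}^{\ell}U_{\lambda_i,2\lambda_i}$ be the direct sum of the uniform matroids of rank $\lambda_i$ on $2\lambda_i$ elements, a matroid of rank $n$ on $2n$ elements, and let $z_\lambda=\prod_{i=1}^n i^{\alpha_i}\alpha_i!$, where $\alpha_i$ is the number of parts of $\lambda$ equal to $i$. Theorem. Let $n\ge 1$. The above is well defined: every matroid of rank $n$ on $[2n]$ has a unique such expansion, and $C_n$ and all $U_\lambda$ with $\lambda\vdash n$ have rank $n$ on $2n$ elements. If $n\ge2$, the Catalan matroid $C_n$ is not extremal, i.e. $p_{[C_n]}$ is not a vertex of $\Omega_{n,2n}$. Moreover $$p_{[C_n]}=\sum_{\lambda\vdash n}\frac1{z_\lambda}\,p_{[U_\lambda]},\qquad \frac1{z_\lambda}>0,\qquad \sum_{\lambda\vdash n}\frac1{z_\lambda}=1,$$ and $p_{[C_n]}$ lies in the relative interior of the convex hull of the points $p_{[U_\lambda]}$, $\lambda\vdash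 n$. -/

import Mathlib

namespace MatroidPolytopes

/-! ### Schubert, uniform and Catalan matroids -/

/-- The componentwise (Gale) order on subsets of `[m]`: `T ≤ S` means `|T| = |S|` and, for every
`i`, the `i`-th smallest element of `T` is at most the `i`-th smallest element of `S`. It is
written here by counting (every initial segment contains at least as many elements of `T` as of
`S`); see `galeLE_iff` for the form with `i`-th smallest elements. -/
def GaleLE {m : ℕ} (T S : Finset (Fin m)) : Prop :=
  T.card = S.card ∧ ∀ j : Fin m, (S.filter (· ≤ j)).card ≤ (T.filter (· ≤ j)).card

theorem galeLE_iff {m k : ℕ} {T S : Finset (Fin m)} (hT : T.card = k) (hS : S.card = k) :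
    GaleLE T S ↔ ∀ i : Fin k, T.orderEmbOfFin hT i ≤ S.orderEmbOfFin hS i := by
  have key : ∀ (A : Finset (Fin m)) (hA : A.card = k) (j : Fin m),
      (A.filter (· ≤ j)).card =
        (Finset.univ.filter (fun i : Fin k => A.orderEmbOfFin hA i ≤ j)).card := by
    intro A hA j
    rw [← Finset.card_map (A.orderEmbOfFin hA).toEmbedding]
    congr 1
    ext x
    simp only [Finset.mem_filter, Finset.mem_map, Finset.mem_univ, true_and]
    constructor
    · rintro ⟨hx, hxj⟩
      have : x ∈ Set.range (A.orderEmbOfFin hA) := by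
        rw [Finset.range_orderEmbOfFin]; exact hx
      obtain ⟨i, rfl⟩ := this
      exact ⟨i, hxj, rfl⟩
    · rintro ⟨i, hi, rfl⟩
      exact ⟨Finset.orderEmbOfFin_mem A hA i, hi⟩
  constructor
  · rintro ⟨-, h⟩ i
    by_contra hlt
    push Not at hlt
    have h1 := h (S.orderEmbOfFin hS i)
    rw [key S hS, key T hT] at h1
    have h2 : (Finset.univ.filter
        (fun l : Fin k => T.orderEmbOfFin hT l ≤ S.orderEmbOfFin hS i)) ⊂
        (Finset.univ.filter
        (fun l : Fin k => S.orderEmbOfFin hS l ≤ S.orderEmbOfFin hS i)) := by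
      rw [Finset.ssubset_iff_of_subset]
      · refine ⟨i, by simp, by simpa using hlt⟩
      · intro l hl
        simp only [Finset.mem_filter, Finset.mem_univ, true_and] at hl ⊢
        have : T.orderEmbOfFin hT l < T.orderEmbOfFin hT i := lt_of_le_of_lt hl hlt
        exact (S.orderEmbOfFin hS).monotone ((T.orderEmbOfFin hT).lt_iff_lt.1 this).le
    exact absurd (Finset.card_lt_card h2) (not_lt.2 h1)
  · intro h
    refine ⟨hT.trans hS.symm, fun j => ?_⟩
    rw [key S hS, key T hT]
    refine Finset.card_le_card fun l hl => ?_
    simp only [Finset.mem_filter, Finset.mem_univ, true_and] at hl ⊢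
    exact (h l).trans hl

theorem galeLE_exchange {m : ℕ} {S T T' : Finset (Fin m)} (hT : GaleLE T S) (hT' : GaleLE T' S)
    {a : Fin m} (ha : a ∈ T) (ha' : a ∉ T') :
    ∃ b ∈ T', b ∉ T ∧ GaleLE (insert b (T.erase a)) S := by
  classical
  -- the smallest tight index that is at least `a`, if there is one
  by_cases hex : ∃ j, a ≤ j ∧ (T.filter (· ≤ j)).card ≤ (S.filter (· ≤ j)).card
  · obtain ⟨j, ⟨haj, hj⟩, hmin⟩ := WellFounded.has_min (wellFounded_lt (α := Fin m))
      {j | a ≤ j ∧ (T.filter (· ≤ j)).card ≤ (S.filter (· ≤ j)).card} hex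
    have hb : ∃ b ∈ T', b ∉ T ∧ b ≤ j := by
      by_contra hcon
      push Not at hcon
      have hsub : T'.filter (· ≤ j) ⊆ T.filter (· ≤ j) := by
        intro x hx
        rw [Finset.mem_filter] at hx ⊢
        refine ⟨?_, hx.2⟩
        by_contra hxT
        exact absurd hx.2 (not_le.2 (hcon x hx.1 hxT))
      have heq := Finset.eq_of_subset_of_card_le hsub (hj.trans (hT'.2 j))
      have : a ∈ T'.filter (· ≤ j) := by
        rw [heq, Finset.mem_filter]; exact ⟨ha, haj⟩
      exact ha' (Finset.mem_filter.1 this).1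
    obtain ⟨b, hbT', hbT, hbj⟩ := hb
    refine ⟨b, hbT', hbT, ?_, fun i => ?_⟩
    · rw [Finset.card_insert_of_notMem (by simp [hbT]), Finset.card_erase_of_mem ha, ← hT.1]
      have := Finset.card_pos.2 ⟨a, ha⟩
      omega
    · rw [Finset.filter_insert, Finset.filter_erase]
      have h0 := hT.2 i
      have h1 : ((T.filter (· ≤ i)).erase a).card + 1 ≥ (T.filter (· ≤ i)).card := by
        have := Finset.pred_card_le_card_erase (s := T.filter (· ≤ i)) (a := a)
        omega
      have h2 : b ∉ (T.filter (· ≤ i)).erase a := by simp [hbT]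
      split_ifs with hbi
      · rw [Finset.card_insert_of_notMem h2]; omega
      · by_cases hai : a ≤ i
        · have hij : i < j := lt_of_lt_of_le (not_le.1 hbi) hbj
          have h3 : ¬ ((T.filter (· ≤ i)).card ≤ (S.filter (· ≤ i)).card) :=
            fun h => hmin i ⟨hai, h⟩ hij
          omega
        · rw [Finset.erase_eq_of_notMem (by simp [hai])]; exact h0
  · exfalso
    have hm : 0 < m := lt_of_le_of_lt (Nat.zero_le _) a.2
    refine hex ⟨⟨m - 1, by omega⟩, ?_, ?_⟩
    · rw [Fin.le_def]; simp only; omega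
    · have hall : ∀ A : Finset (Fin m),
          A.filter (fun x => x ≤ (⟨m - 1, by omega⟩ : Fin m)) = A := by
        intro A
        refine Finset.filter_true_of_mem fun x _ => ?_
        rw [Fin.le_def]; simp only; omega
      rw [hall, hall]; exact hT.1.le

/-- The Schubert matroid `SM_m(S)`: the matroid on `[m]` whose bases are the sets `T ≤ S`. -/
noncomputable def schubertMatroid {m : ℕ} (S : Finset (Fin m)) : Matroid (Fin m) :=
  Matroid.ofIsBaseOfFinite (E := Set.univ) Set.finite_univ
    (fun B => ∃ T : Finset (Fin m), (T : Set (Fin m)) = B ∧ GaleLE T S)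
    ⟨S, S, rfl, rfl, fun _ => le_rfl⟩
    (by
      classical
      rintro _ _ ⟨T, rfl, hT⟩ ⟨T', rfl, hT'⟩ a ha
      obtain ⟨b, hb, hbT, h⟩ := galeLE_exchange hT hT' (by simpa using ha.1) (by simpa using ha.2)
      refine ⟨b, ⟨by simpa using hb, by simpa using hbT⟩, insert b (T.erase a), ?_, h⟩
      push_cast
      rfl)
    (fun _ _ => Set.subset_univ _)

/-- The uniform matroid `U_{k,N}` with `k ≤ N` on the ground set `[N]`: its bases are all the
`k`-element subsets. -/
noncomputable def uniformMatroid (k N : ℕ) (h : k ≤ N) : Matroid (Fin N) :=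
  Matroid.ofIsBaseOfFinite (E := Set.univ) Set.finite_univ
    (fun B => ∃ T : Finset (Fin N), (T : Set (Fin N)) = B ∧ T.card = k)
    (by
      obtain ⟨T, -, hT⟩ := Finset.exists_subset_card_eq
        (s := (Finset.univ : Finset (Fin N))) (n := k) (by simpa using h)
      exact ⟨T, T, rfl, hT⟩)
    (by
      classical
      rintro _ _ ⟨T, rfl, hT⟩ ⟨T', rfl, hT'⟩ a ha
      have haT : a ∈ T := by simpa using ha.1
      have haT' : a ∉ T' := by simpa using ha.2
      have hb : ∃ b ∈ T', b ∉ T := by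
        by_contra hcon
        push Not at hcon
        have := Finset.eq_of_subset_of_card_le (s := T') (t := T) hcon (by omega)
        exact haT' (this ▸ haT)
      obtain ⟨b, hbT', hbT⟩ := hb
      refine ⟨b, ⟨by simpa using hbT', by simpa using hbT⟩, insert b (T.erase a), ?_, ?_⟩
      · push_cast
        rfl
      · rw [Finset.card_insert_of_notMem (by simp [hbT]), Finset.card_erase_of_mem haT, hT]
        have := Finset.card_pos.2 ⟨a, haT⟩
        omega)
    (fun _ _ => Set.subset_univ _)

/-- The Catalan matroid `C_n`: the Schubert matroid on `[2n]` given by `S = {2, 4, …, 2n}`, i.e. by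
the indicator vector `(0,1,0,1,…,0,1)`. (The elements `1, …, 2n` are `0, …, 2n-1` in `Fin (2n)`.) -/
noncomputable def catalanMatroid (n : ℕ) : Matroid (Fin (2 * n)) :=
  schubertMatroid (Finset.univ.filter fun i => (i : ℕ) % 2 = 1)

theorem card_blocks {n : ℕ} (p : n.Partition) :
    Fintype.card (Σ i : p.parts.ToType, Fin (2 * i.1)) = 2 * n := by
  have h : (p.parts.map fun x => 2 * x).sum = ∑ i : p.parts.ToType, 2 * i.1 := by
    rw [Finset.sum_eq_multiset_sum]
    congr 1
    exact (Multiset.map_univ p.parts (fun x => 2 * x)).symm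
  rw [Fintype.card_sigma]
  simp only [Fintype.card_fin]
  rw [← h, Multiset.sum_map_mul_left, Multiset.map_id', p.parts_sum]

/-- `U_λ`, for a partition `λ = (λ_1, …, λ_k)` of `n`: the direct sum of the uniform matroids
`U_{λ_i, 2 λ_i}`, transported to the ground set `[2n]` by some bijection. -/
noncomputable def uniformSum {n : ℕ} (p : n.Partition) : Matroid (Fin (2 * n)) :=
  (Matroid.sigma fun i : p.parts.ToType =>
    uniformMatroid i.1 (2 * i.1) (Nat.le_mul_of_pos_left _ two_pos)).mapEquiv
      (Fintype.equivFinOfCardEq (card_blocks p))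

/-- `z_λ = ∏_{i=1}^n i^{α_i} α_i!`, where `α_i` is the number of parts of `λ` equal to `i`. -/
def zPart {n : ℕ} (p : n.Partition) : ℕ :=
  ∏ i ∈ Finset.Icc 1 n, i ^ p.parts.count i * (p.parts.count i).factorial

/-! ### Matroid polytopes, Schubert expansions and the polytope of all matroids -/

/-- The matroid polytope: the convex hull of the vectors `e_B`, for the bases `B` of `M`. -/
def matroidPolytope {m : ℕ} (M : Matroid (Fin m)) : Set (Fin m → ℝ) :=
  convexHull ℝ {v | ∃ B, M.IsBase B ∧ v = B.indicator fun _ => 1}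

/-- `M` is a matroid on the whole ground set `[m]`, of rank `k`. -/
def IsMatroidOfRank (k : ℕ) {m : ℕ} (M : Matroid (Fin m)) : Prop :=
  M.E = Set.univ ∧ M.eRank = k

/-- Isomorphism of matroids on `[m]`. -/
def Iso {m : ℕ} (M N : Matroid (Fin m)) : Prop :=
  ∃ σ : Equiv.Perm (Fin m), N = M.mapEquiv σ

/-- The (labeled) Schubert matroids on `[m]` of rank `k`: all matroids on `[m]` that are isomorphic
to `SM_m(S)` for some `k`-element subset `S` of `[m]`. -/
def LabeledSchubert (k m : ℕ) : Type :=
  {N : Matroid (Fin m) // ∃ S : Finset (Fin m), S.card = k ∧ Iso (schubertMatroid S) N}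

/-- `c` is a Schubert expansion of `M`: an integral linear combination of indicator functions of
polytopes of rank `k` Schubert matroids on `[m]` that equals the indicator function of the polytope
of `M`. -/
def IsSchubertExpansion {k m : ℕ} (M : Matroid (Fin m)) (c : LabeledSchubert k m →₀ ℤ) : Prop :=
  ∀ x : Fin m → ℝ, (matroidPolytope M).indicator (fun _ => (1 : ℤ)) x =
    c.sum fun N a => a * (matroidPolytope N.1).indicator (fun _ => (1 : ℤ)) x

open Classical in
/-- The labeled coordinate vector `p_M`: the coefficients of the unique Schubert expansion of `M`
(every matroid on `[m]` of rank `k` has exactly one). -/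
noncomputable def labeledCoord (k : ℕ) {m : ℕ} (M : Matroid (Fin m)) : LabeledSchubert k m →₀ ℤ :=
  if h : ∃! c : LabeledSchubert k m →₀ ℤ, IsSchubertExpansion M c then h.choose else 0

/-- Isomorphism, as an equivalence relation on labeled Schubert matroids. -/
def schubertSetoid (k m : ℕ) : Setoid (LabeledSchubert k m) where
  r M N := Iso M.1 N.1
  iseqv :=
    { refl := fun M => ⟨Equiv.refl _, by
        refine Matroid.ext_isBase (by simp) fun B _ => ?_
        simp⟩
      symm := by
        rintro M N ⟨σ, h⟩
        refine ⟨σ.symm, Matroid.ext_isBase ?_ fun B _ => ?_⟩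
        · rw [h]; simp [Set.image_image]
        · rw [h]; simp [Set.image_image]
      trans := by
        rintro M N P ⟨σ, h⟩ ⟨τ, h'⟩
        refine ⟨σ.trans τ, Matroid.ext_isBase ?_ fun B _ => ?_⟩
        · rw [h', h]; simp [Set.image_image]
        · rw [h', h]; simp [Set.image_image] }

/-- Isomorphism classes of Schubert matroids of rank `k` on `m` elements. -/
def SchubertClass (k m : ℕ) : Type := Quotient (schubertSetoid k m)

/-- The coordinate vector `p_{[M]}` of the isomorphism class of `M`: the image of `p_M` under the
natural projection that adds up the coordinates of isomorphic Schubert matroids. -/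
noncomputable def coordVec (k : ℕ) {m : ℕ} (M : Matroid (Fin m)) : SchubertClass k m → ℝ :=
  fun s => (((labeledCoord k M).mapDomain (Quotient.mk (schubertSetoid k m)) s : ℤ) : ℝ)

/-- The (unlabeled) polytope of all matroids `Ω_{k,m}`: the convex hull of the coordinate vectors
`p_{[M]}` of all matroids `M` on `[m]` of rank `k`. -/
def Omega (k m : ℕ) : Set (SchubertClass k m → ℝ) :=
  convexHull ℝ {v | ∃ M : Matroid (Fin m), IsMatroidOfRank k M ∧ v = coordVec k M}

/-- A matroid of rank `k` on `[m]` is extremal if its coordinate vector is a vertex of `Ω_{k,m}`. -/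
def IsExtremal (k : ℕ) {m : ℕ} (M : Matroid (Fin m)) : Prop :=
  coordVec k M ∈ (Omega k m).extremePoints ℝ

end MatroidPolytopes

open MatroidPolytopes

/-! The identity is a symmetrization. For x in the unit cube with coordinate sum n, put y_i =
x_{2i-1} + x_{2i} - 1, a zero-sum vector (`excess`). Then x lies in the polytope of C_n exactly when
all partial sums of y are nonnegative, and permuting the n pairs permutes y. On the other side, fix
a permutation τ of the pairs and give each cycle of length l, with its 2l elements, a copy of
U_{l,2l}. The resulting matroid is a relabeling of U_λ, λ the cycle type of τ, and its polytope
contains x exactly when y sums to zero on every cycle of τ. A lemma of Spitzer type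
(`numNonneg_eq_numBalanced`) says that y has as many orderings with nonnegative partial sums as
there are permutations with zero-sum cycles. Hence the n! relabelings of C_n and the n! relabeled
U_λ have the same sum of indicator functions. Coordinate vectors are additive on such relations and
blind to relabeling, so n! p_[C_n] is the sum of the p_[U_λ] over all permutations, and n!/z_λ of
these have cycle type λ.

Additivity rests on unique Schubert expansions. Uniqueness: a linear relation between indicators of
compact convex sets survives counting the nonempty ones (`sum_nonempty_eq_zero`); cutting with
half-spaces whose functional is a linear extension of the Gale order isolates one labeled Schubert
matroid. Existence: alternating sums over chains of rank inequalities collapse, since by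
submodularity the inequalities violated at a point form a contractible family; each chain alone cuts
out a labeled Schubert polytope (`exists_labeledSchubert_of_monotone`).

All weights 1/z_λ are positive, which gives the relative interior. If p_[C_n] were a vertex, every
p_[U_λ] would equal it; but U_{n,2n} and C_n are themselves Schubert matroids, nonisomorphic for n ≥
2, so their coordinate vectors are distinct unit vectors. -/

namespace MatroidPolytopes

open Finset

variable {m k n : ℕ}

/-! ### Ranks, greedy bases and Edmonds' description of the matroid polytope -/

/-- The rank of a set in a matroid on `[m]`, as a natural number. -/
noncomputable def natRk (M : Matroid (Fin m)) (F : Finset (Fin m)) : ℕ := (M.eRk F).toNat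

theorem coe_natRk (M : Matroid (Fin m)) (F : Finset (Fin m)) : (natRk M F : ℕ∞) = M.eRk F := by
  refine ENat.natCast_toNat fun h => ?_
  have := M.eRk_le_encard (F : Set (Fin m))
  rw [h, Set.encard_coe_eq_coe_finsetCard] at this
  simp at this

theorem card_eq_of_isBase {M : Matroid (Fin m)} (hM : IsMatroidOfRank k M) {B : Finset (Fin m)}
    (hB : M.IsBase B) : B.card = k := by
  have h := hB.encard_eq_eRank
  rw [hM.2, Set.encard_coe_eq_coe_finsetCard] at h
  exact_mod_cast h

theorem card_inter_le_natRk {M : Matroid (Fin m)} {B : Finset (Fin m)} (hB : M.IsBase B)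
    (F : Finset (Fin m)) : (B ∩ F).card ≤ natRk M F := by
  have h := (hB.indep.subset (Set.inter_subset_left (t := (F : Set (Fin m))))).encard_le_eRk_of_subset
    Set.inter_subset_right
  rw [← coe_natRk, ← Finset.coe_inter, Set.encard_coe_eq_coe_finsetCard] at h
  exact_mod_cast h

theorem natRk_inter_add_union_le (M : Matroid (Fin m)) (F G : Finset (Fin m)) :
    natRk M (F ∩ G) + natRk M (F ∪ G) ≤ natRk M F + natRk M G := by
  have h := M.eRk_inter_add_eRk_union_le (F : Set (Fin m)) G
  rw [← Finset.coe_inter, ← Finset.coe_union] at h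
  simp only [← coe_natRk] at h
  exact_mod_cast h

/-- A basis of X N extends to a basis of X (N + 1) that has the same intersection with X N, so
nothing achieved on the earlier sets is lost. -/
theorem exists_isBasis_chain (M : Matroid (Fin m)) (hM : M.E = Set.univ) (X : ℕ → Set (Fin m))
    (hX : Monotone X) (N : ℕ) :
    ∃ I, M.IsBasis I (X N) ∧ ∀ j ≤ N, M.IsBasis (I ∩ X j) (X j) := by
  induction N with
  | zero =>
    obtain ⟨I, hI⟩ := M.exists_isBasis (X 0) (by simp [hM])
    refine ⟨I, hI, fun j hj => ?_⟩
    obtain rfl : j = 0 := by omega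
    rwa [Set.inter_eq_left.2 hI.subset]
  | succ N ih =>
    obtain ⟨I, hI, hI'⟩ := ih
    obtain ⟨J, hJ, hIJ⟩ := hI.exists_isBasis_inter_eq_of_superset (hX N.le_succ) (by simp [hM])
    refine ⟨J, hJ, fun j hj => ?_⟩
    rcases hj.lt_or_eq with hlt | rfl
    · have hj' : j ≤ N := by omega
      have : J ∩ X j = I ∩ X j := by
        rw [← hIJ, Set.inter_assoc, Set.inter_eq_right.2 (hX hj')]
      rw [this]
      exact hI' j hj'
    · rwa [Set.inter_eq_left.2 hJ.subset]

/-- A greedy basis: it meets every member of an increasing sequence in a maximum independent set. -/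
theorem exists_greedy_base {M : Matroid (Fin m)} (hM : M.E = Set.univ)
    (X : ℕ → Finset (Fin m)) (hX : Monotone X) :
    ∃ B : Finset (Fin m), M.IsBase B ∧ ∀ j, (B ∩ X j).card = natRk M (X j) := by
  classical
  obtain ⟨N, hN⟩ : ∃ N, ∀ j ≥ N, X j = X N := by
    have : WellFoundedGT (Finset (Fin m)) := Finite.to_wellFoundedGT
    obtain ⟨N, hN⟩ := WellFoundedGT.monotone_chain_condition ⟨X, hX⟩
    exact ⟨N, fun j hj => (hN j hj).symm⟩
  obtain ⟨I, hI, hI'⟩ := exists_isBasis_chain M hM (fun j => (X j : Set (Fin m)))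
    (fun a b h => by simpa using hX h) N
  obtain ⟨B, hB, hIB⟩ := hI.exists_isBasis_inter_eq_of_superset
    (Set.subset_univ _) (by simp [hM])
  rw [← hM, Matroid.isBasis_ground_iff] at hB
  refine ⟨B.toFinset, by simpa using hB, fun j => ?_⟩
  have key : ∀ j ≤ N, (B.toFinset ∩ X j).card = natRk M (X j) := by
    intro j hj
    have h := hI' j hj
    have h2 : I ∩ X j = B ∩ X j := by
      rw [← hIB, Set.inter_assoc, Set.inter_eq_self_of_subset_right
        (show (X j : Set (Fin m)) ⊆ X N by simpa using hX hj)]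
    rw [h2] at h
    have h3 := h.encard_eq_eRk
    rw [← coe_natRk] at h3
    have h4 : B ∩ (X j : Set (Fin m)) = ((B.toFinset ∩ X j : Finset (Fin m)) : Set (Fin m)) := by
      simp
    rw [h4, Set.encard_coe_eq_coe_finsetCard] at h3
    exact_mod_cast h3
  rcases le_total j N with h | h
  · exact key j h
  · rw [hN j h]
    exact key N le_rfl

/-- Abel summation for a decreasing sequence of weights. -/
theorem sum_mul_le_of_partial_sums_nonpos : ∀ {m : ℕ} (a z : Fin m → ℝ), Antitone a →
    (∀ j : ℕ, ∑ i : Fin m, (if (i : ℕ) < j then z i else 0) ≤ 0) → ∑ i, z i = 0 →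
    ∑ i, a i * z i ≤ 0 := by
  -- The induction drops the last entry, which destroys the condition of total sum zero; the bound
  -- is therefore stated with the last weight times the total.
  have key : ∀ (m : ℕ) (a z : Fin (m + 1) → ℝ), Antitone a →
      (∀ j : ℕ, ∑ i : Fin (m + 1), (if (i : ℕ) < j then z i else 0) ≤ 0) →
      ∑ i, a i * z i ≤ a (Fin.last m) * ∑ i, z i := by
    intro m
    induction m with
    | zero => intro a z _ _; simp
    | succ m ih =>
      intro a z ha hz
      have hz' : ∀ j : ℕ, ∑ i : Fin (m + 1), (if (i : ℕ) < j then z i.castSucc else 0) ≤ 0 := by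
        intro j
        have := hz (min j (m + 1))
        rw [Fin.sum_univ_castSucc] at this
        simpa [Fin.is_le] using this
      have h1 := ih (fun i => a i.castSucc) (fun i => z i.castSucc)
        (fun i j h => ha (by simpa using h)) hz'
      have h2 : ∑ i : Fin (m + 1), z i.castSucc ≤ 0 := by
        have := hz' (m + 1)
        simpa [Fin.is_le] using this
      have h3 : a (Fin.last (m + 1)) ≤ a (Fin.last m).castSucc := ha (Fin.le_last _)
      rw [Fin.sum_univ_castSucc, Fin.sum_univ_castSucc (f := z)]
      nlinarith
  intro m a z ha hz h0
  cases m with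
  | zero => simp
  | succ m => simpa [h0] using key m a z ha hz

/-- The indicator vector `e_B`. -/
noncomputable def indVec (B : Finset (Fin m)) : Fin m → ℝ := (B : Set (Fin m)).indicator fun _ => 1

theorem sum_indVec (B F : Finset (Fin m)) : ∑ i ∈ F, indVec B i = (B ∩ F).card := by
  classical
  simp only [indVec, Set.indicator_apply, Finset.sum_ite, Finset.sum_const_zero, add_zero,
    Finset.sum_const, nsmul_eq_mul, mul_one, Finset.mem_coe]
  rw [Finset.filter_mem_eq_inter, Finset.inter_comm]

theorem matroidPolytope_eq (M : Matroid (Fin m)) :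
    matroidPolytope M = convexHull ℝ (indVec '' {B : Finset (Fin m) | M.IsBase B}) := by
  classical
  unfold matroidPolytope
  congr 1
  ext v
  constructor
  · rintro ⟨B, hB, rfl⟩
    exact ⟨B.toFinset, by simpa using hB, by simp [indVec]⟩
  · rintro ⟨B, hB, rfl⟩
    exact ⟨B, hB, rfl⟩

theorem indVec_mem_matroidPolytope {M : Matroid (Fin m)} {B : Finset (Fin m)} (hB : M.IsBase B) :
    indVec B ∈ matroidPolytope M :=
  subset_convexHull _ _ ⟨B, hB, rfl⟩

theorem isCompact_matroidPolytope (M : Matroid (Fin m)) : IsCompact (matroidPolytope M) := by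
  rw [matroidPolytope_eq]
  exact (Set.toFinite _).isCompact_convexHull ℝ

theorem convex_matroidPolytope (M : Matroid (Fin m)) : Convex ℝ (matroidPolytope M) :=
  convex_convexHull _ _

theorem sum_le_of_mem_matroidPolytope {M : Matroid (Fin m)} {x w : Fin m → ℝ} {t : ℝ}
    (hx : x ∈ matroidPolytope M)
    (h : ∀ B : Finset (Fin m), M.IsBase B → ∑ i, w i * indVec B i ≤ t) :
    ∑ i, w i * x i ≤ t := by
  rw [matroidPolytope_eq] at hx
  have hc : Convex ℝ {x : Fin m → ℝ | ∑ i, w i * x i ≤ t} :=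
    convex_halfSpace_le (f := fun x : Fin m → ℝ => ∑ i, w i * x i)
      ⟨fun x y => by simp [mul_add, Finset.sum_add_distrib],
       fun c x => by simp [Finset.mul_sum, mul_left_comm]⟩ t
  refine convexHull_min ?_ hc hx
  rintro _ ⟨B, hB, rfl⟩
  exact h B hB

theorem sum_subset_le_of_mem_matroidPolytope {M : Matroid (Fin m)} {x : Fin m → ℝ}
    (hx : x ∈ matroidPolytope M) (F : Finset (Fin m)) {t : ℝ}
    (h : ∀ B : Finset (Fin m), M.IsBase B → ((B ∩ F).card : ℝ) ≤ t) :
    ∑ i ∈ F, x i ≤ t := by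
  classical
  have := sum_le_of_mem_matroidPolytope (w := fun i => if i ∈ F then 1 else 0) (t := t) hx
    fun B hB => by simpa [sum_indVec] using h B hB
  simpa using this

theorem le_sum_subset_of_mem_matroidPolytope {M : Matroid (Fin m)} {x : Fin m → ℝ}
    (hx : x ∈ matroidPolytope M) (F : Finset (Fin m)) {t : ℝ}
    (h : ∀ B : Finset (Fin m), M.IsBase B → t ≤ ((B ∩ F).card : ℝ)) :
    t ≤ ∑ i ∈ F, x i := by
  classical
  have := sum_le_of_mem_matroidPolytope (w := fun i => if i ∈ F then -1 else 0) (t := -t) hx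
    fun B hB => by simpa [sum_indVec] using h B hB
  simpa using this

theorem mem_Icc_of_mem_matroidPolytope {M : Matroid (Fin m)} {x : Fin m → ℝ}
    (hx : x ∈ matroidPolytope M) (i : Fin m) : 0 ≤ x i ∧ x i ≤ 1 := by
  constructor
  · simpa using le_sum_subset_of_mem_matroidPolytope hx {i} (t := 0) fun B _ => by positivity
  · simpa using sum_subset_le_of_mem_matroidPolytope hx {i} (t := 1) fun B _ => by
      exact_mod_cast (Finset.card_le_card Finset.inter_subset_right).trans (by simp)

theorem sum_eq_of_mem_matroidPolytope {M : Matroid (Fin m)} (hM : IsMatroidOfRank k M)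
    {x : Fin m → ℝ} (hx : x ∈ matroidPolytope M) : ∑ i, x i = k := by
  refine le_antisymm ?_ ?_
  · exact sum_subset_le_of_mem_matroidPolytope hx Finset.univ
      fun B hB => by simp [card_eq_of_isBase hM hB]
  · exact le_sum_subset_of_mem_matroidPolytope hx Finset.univ
      fun B hB => by simp [card_eq_of_isBase hM hB]

/-- A vector whose coordinate sums over all sets are bounded by the rank lies in the polytope. -/
theorem mem_matroidPolytope_of_forall_sum_le {M : Matroid (Fin m)} (hM : IsMatroidOfRank k M)
    {x : Fin m → ℝ} (h0 : ∑ i, x i = k) (h : ∀ F : Finset (Fin m), ∑ i ∈ F, x i ≤ natRk M F) :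
    x ∈ matroidPolytope M := by
  classical
  by_contra hx
  obtain ⟨f, u, hf, hu⟩ := geometric_hahn_banach_closed_point (convex_matroidPolytope M)
    (isCompact_matroidPolytope M).isClosed hx
  set w : Fin m → ℝ := fun i => f (Pi.single i 1) with hw
  have hfw : ∀ y : Fin m → ℝ, f y = ∑ i, w i * y i := by
    intro y
    conv_lhs => rw [← Finset.univ_sum_single y]
    rw [map_sum]
    refine Finset.sum_congr rfl fun i _ => ?_
    have : (Pi.single i (y i) : Fin m → ℝ) = y i • Pi.single i 1 := by
      rw [← Pi.single_smul]; simp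
    rw [this, map_smul, smul_eq_mul, mul_comm]
  -- The greedy algorithm: sort the elements by decreasing weight of the separating functional. A
  -- base greedy for the initial segments of this order dominates x on each of them, so by Abel
  -- summation its weight is at least that of x, contradicting the separation.
  set e : Equiv.Perm (Fin m) := Tuple.sort (fun i => -w i) with he
  have hmono : Antitone (w ∘ e) := by
    have := Tuple.monotone_sort (fun i => -w i)
    intro i j hij
    have := this hij
    simpa using this
  set X : ℕ → Finset (Fin m) := fun j => Finset.univ.filter fun a => (e.symm a : ℕ) < j with hX
  obtain ⟨B, hB, hBX⟩ := exists_greedy_base hM.1 X (by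
    intro a b hab i hi
    simp only [hX, Finset.mem_filter, Finset.mem_univ, true_and] at hi ⊢
    omega)
  have hBk := card_eq_of_isBase hM hB
  have hsum : ∀ (z : Fin m → ℝ) (j : ℕ),
      ∑ i : Fin m, (if (i : ℕ) < j then z (e i) else 0) = ∑ i ∈ X j, z i := by
    intro z j
    have := Equiv.sum_comp e (fun a => if (e.symm a : ℕ) < j then z a else 0)
    simp only [Equiv.symm_apply_apply] at this
    rw [this, hX, Finset.sum_filter]
  have := sum_mul_le_of_partial_sums_nonpos (w ∘ e) (fun i => (x - indVec B) (e i)) hmono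
    (fun j => by
      rw [hsum]
      simp only [Pi.sub_apply, Finset.sum_sub_distrib, sum_indVec, hBX]
      linarith [h (X j)])
    (by
      rw [Equiv.sum_comp e (x - indVec B)]
      simp only [Pi.sub_apply, Finset.sum_sub_distrib, sum_indVec, h0]
      simp [hBk])
  simp only [Function.comp] at this
  rw [Equiv.sum_comp e (fun i => w i * (x - indVec B) i)] at this
  simp only [Pi.sub_apply, mul_sub, Finset.sum_sub_distrib, ← hfw] at this
  linarith [hf _ (indVec_mem_matroidPolytope hB)]

theorem mem_matroidPolytope_iff {M : Matroid (Fin m)} (hM : IsMatroidOfRank k M)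
    {x : Fin m → ℝ} :
    x ∈ matroidPolytope M ↔ ∑ i, x i = k ∧ ∀ F : Finset (Fin m), ∑ i ∈ F, x i ≤ natRk M F :=
  ⟨fun hx => ⟨sum_eq_of_mem_matroidPolytope hM hx, fun F =>
    sum_subset_le_of_mem_matroidPolytope hx F fun B hB => by exact_mod_cast card_inter_le_natRk hB F⟩,
   fun h => mem_matroidPolytope_of_forall_sum_le hM h.1 h.2⟩

/-- The form of Edmonds' criterion used for concrete matroids: exhibiting one good base per set
avoids computing ranks. -/
theorem mem_matroidPolytope_of_forall_exists_base {M : Matroid (Fin m)} (hM : IsMatroidOfRank k M)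
    {x : Fin m → ℝ} (h0 : ∑ i, x i = k)
    (h : ∀ F : Finset (Fin m), ∃ B : Finset (Fin m), M.IsBase B ∧ ∑ i ∈ F, x i ≤ (B ∩ F).card) :
    x ∈ matroidPolytope M := by
  refine mem_matroidPolytope_of_forall_sum_le hM h0 fun F => ?_
  obtain ⟨B, hB, hF⟩ := h F
  exact hF.trans (by exact_mod_cast card_inter_le_natRk hB F)

/-! ### Relabeling -/

theorem isBase_mapEquiv_image {M : Matroid (Fin m)} (σ : Equiv.Perm (Fin m)) {B : Finset (Fin m)} :
    (M.mapEquiv σ).IsBase (B.map σ.toEmbedding : Finset (Fin m)) ↔ M.IsBase B := by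
  simp [Matroid.mapEquiv_isBase_iff, Set.image_image]

theorem IsMatroidOfRank.mapEquiv {M : Matroid (Fin m)} (hM : IsMatroidOfRank k M)
    (σ : Equiv.Perm (Fin m)) : IsMatroidOfRank k (M.mapEquiv σ) := by
  refine ⟨by simp [hM.1], ?_⟩
  obtain ⟨B, hB⟩ := M.exists_isBase
  have h1 : (M.mapEquiv σ).IsBase (σ '' B) := by
    simpa [Matroid.mapEquiv_isBase_iff, Set.image_image] using hB
  rw [← h1.encard_eq_eRank, σ.injective.encard_image, hB.encard_eq_eRank, hM.2]

theorem mem_matroidPolytope_mapEquiv {M : Matroid (Fin m)} (σ : Equiv.Perm (Fin m))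
    {x : Fin m → ℝ} : x ∈ matroidPolytope (M.mapEquiv σ) ↔ x ∘ σ ∈ matroidPolytope M := by
  classical
  have key : ∀ (M : Matroid (Fin m)) (σ : Equiv.Perm (Fin m)) (x : Fin m → ℝ),
      x ∈ matroidPolytope (M.mapEquiv σ) → x ∘ σ ∈ matroidPolytope M := by
    intro M σ x hx
    have : LinearMap.funLeft ℝ ℝ σ '' matroidPolytope (M.mapEquiv σ) ⊆ matroidPolytope M := by
      unfold matroidPolytope
      rw [LinearMap.image_convexHull]
      refine convexHull_mono ?_
      rintro _ ⟨_, ⟨B, hB, rfl⟩, rfl⟩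
      rw [Matroid.mapEquiv_isBase_iff] at hB
      refine ⟨_, hB, ?_⟩
      ext i
      simp [LinearMap.funLeft_apply, Set.indicator_apply, Equiv.image_symm_eq_preimage]
    exact this ⟨x, hx, rfl⟩
  refine ⟨key M σ x, fun h => ?_⟩
  have h2 : (M.mapEquiv σ).mapEquiv σ.symm = M := by
    refine Matroid.ext_isBase (by simp [Set.image_image]) fun B _ => by simp [Set.image_image]
  have := key (M.mapEquiv σ) σ.symm (x ∘ σ) (by rwa [h2])
  simpa [Function.comp_assoc] using this

/-! ### Polytopes of Schubert matroids -/

theorem isBase_schubertMatroid {S B : Finset (Fin m)} :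
    (schubertMatroid S).IsBase B ↔ GaleLE B S := by
  simp only [schubertMatroid]
  exact ⟨by rintro ⟨T, hT, h⟩; rwa [← Finset.coe_injective hT], fun h => ⟨B, rfl, h⟩⟩

theorem GaleLE.refl (S : Finset (Fin m)) : GaleLE S S := ⟨rfl, fun _ => le_rfl⟩

theorem isMatroidOfRank_schubertMatroid {S : Finset (Fin m)} (hS : S.card = k) :
    IsMatroidOfRank k (schubertMatroid S) := by
  refine ⟨rfl, ?_⟩
  rw [← (isBase_schubertMatroid.2 (GaleLE.refl S)).encard_eq_eRank,
    Set.encard_coe_eq_coe_finsetCard, hS]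

theorem card_filter_le_add_card_filter_not_le (T : Finset (Fin m)) (j : Fin m) :
    (T.filter (· ≤ j)).card + (T.filter (¬ · ≤ j)).card = T.card :=
  Finset.card_filter_add_card_filter_not (s := T) (· ≤ j)

/-- Replacing an element by another one preserves the Gale order unless a tight initial segment
separates them. -/
theorem GaleLE.exists_tight {S T : Finset (Fin m)} (hT : GaleLE T S) {a b : Fin m} (ha : a ∉ T)
    (hb : b ∈ T) (h : ¬ GaleLE (insert a (T.erase b)) S) :
    ∃ j, b ≤ j ∧ j < a ∧ (T.filter (· ≤ j)).card = (S.filter (· ≤ j)).card := by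
  have hcard : (insert a (T.erase b)).card = S.card := by
    rw [Finset.card_insert_of_notMem (by simp [ha]), Finset.card_erase_of_mem hb, ← hT.1]
    have := Finset.card_pos.2 ⟨b, hb⟩
    omega
  have h' : ∃ j, ((insert a (T.erase b)).filter (· ≤ j)).card < (S.filter (· ≤ j)).card := by
    by_contra hcon
    push Not at hcon
    exact h ⟨hcard, hcon⟩
  obtain ⟨j, hj⟩ := h'
  have h0 := hT.2 j
  rw [Finset.filter_insert, Finset.filter_erase] at hj
  have h2 : a ∉ (T.filter (· ≤ j)).erase b := by simp [ha]
  have h1 : (T.filter (· ≤ j)).card ≤ ((T.filter (· ≤ j)).erase b).card + 1 := by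
    have := Finset.pred_card_le_card_erase (s := T.filter (· ≤ j)) (a := b)
    omega
  split_ifs at hj with haj
  · rw [Finset.card_insert_of_notMem h2] at hj
    omega
  · by_cases hbj : b ≤ j
    · exact ⟨j, hbj, not_le.1 haj, by omega⟩
    · rw [Finset.erase_eq_of_notMem (by simp [hbj])] at hj
      omega

/-- For the converse, take a base T with |T ∩ F| maximal. The smallest a in F \ T cannot replace the
largest b in T \ F, so some tight initial segment ends at j with b ≤ j < a. Up to j all of F lies in
T, beyond j all of T lies in F, and |T ∩ F| is computed exactly; the bounds on x over the two ranges
then add up. -/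
theorem mem_matroidPolytope_schubertMatroid {S : Finset (Fin m)} {x : Fin m → ℝ} :
    x ∈ matroidPolytope (schubertMatroid S) ↔
      (∀ i, 0 ≤ x i ∧ x i ≤ 1) ∧ ∑ i, x i = S.card ∧
        ∀ j, ((S.filter (· ≤ j)).card : ℝ) ≤ ∑ i ∈ Finset.univ.filter (· ≤ j), x i := by
  classical
  have hM := isMatroidOfRank_schubertMatroid (rfl : S.card = S.card)
  constructor
  · intro hx
    refine ⟨fun i => mem_Icc_of_mem_matroidPolytope hx i, sum_eq_of_mem_matroidPolytope hM hx,
      fun j => le_sum_subset_of_mem_matroidPolytope hx _ fun B hB => ?_⟩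
    have := (isBase_schubertMatroid.1 hB).2 j
    rw [Finset.inter_filter, Finset.inter_univ]
    exact_mod_cast this
  · rintro ⟨h01, hsum, hx⟩
    refine mem_matroidPolytope_of_forall_exists_base hM hsum fun F => ?_
    obtain ⟨T, hT, hmax⟩ := Finset.exists_max_image
      (Finset.univ.filter fun T : Finset (Fin m) => (schubertMatroid S).IsBase T)
      (fun T => (T ∩ F).card) ⟨S, by simp [isBase_schubertMatroid, GaleLE.refl]⟩
    simp only [Finset.mem_filter, Finset.mem_univ, true_and, isBase_schubertMatroid] at hT hmax
    refine ⟨T, isBase_schubertMatroid.2 hT, ?_⟩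
    have hsub : ∀ G : Finset (Fin m), ∑ i ∈ G, x i ≤ G.card := fun G => by
      simpa using Finset.sum_le_card_nsmul G x 1 fun i _ => (h01 i).2
    rcases (F \ T).eq_empty_or_nonempty with hFT | hFT
    · rw [Finset.inter_eq_right.2 (Finset.sdiff_eq_empty_iff_subset.1 hFT)]
      exact hsub F
    rcases (T \ F).eq_empty_or_nonempty with hTF | hTF
    · rw [Finset.inter_eq_left.2 (Finset.sdiff_eq_empty_iff_subset.1 hTF), hT.1, ← hsum]
      exact Finset.sum_le_sum_of_subset_of_nonneg (Finset.subset_univ _) fun i _ _ => (h01 i).1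
    set a := (F \ T).min' hFT with ha
    set b := (T \ F).max' hTF with hb
    have haF := Finset.mem_sdiff.1 ((F \ T).min'_mem hFT)
    have hbT := Finset.mem_sdiff.1 ((T \ F).max'_mem hTF)
    rw [← ha] at haF
    rw [← hb] at hbT
    have hnot : ¬ GaleLE (insert a (T.erase b)) S := by
      intro hG
      have := hmax _ hG
      rw [Finset.insert_inter_of_mem haF.1, Finset.erase_inter,
        Finset.erase_eq_of_notMem (by simp [hbT.2]),
        Finset.card_insert_of_notMem (by simp [haF.2])] at this
      omega
    obtain ⟨j, hbj, hja, htight⟩ := hT.exists_tight haF.2 hbT.1 hnot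
    have h1 : T ∩ F = F.filter (· ≤ j) ∪ T.filter (¬ · ≤ j) := by
      ext i
      simp only [Finset.mem_inter, Finset.mem_union, Finset.mem_filter]
      constructor
      · rintro ⟨hi, hi'⟩
        by_cases hij : i ≤ j
        · exact Or.inl ⟨hi', hij⟩
        · exact Or.inr ⟨hi, hij⟩
      · rintro (⟨hi, hij⟩ | ⟨hi, hij⟩)
        · refine ⟨?_, hi⟩
          by_contra hiT
          have := (F \ T).min'_le i (Finset.mem_sdiff.2 ⟨hi, hiT⟩)
          rw [← ha] at this
          exact absurd (lt_of_lt_of_le hja this) (not_lt.2 hij)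
        · refine ⟨hi, ?_⟩
          by_contra hiF
          have := (T \ F).le_max' i (Finset.mem_sdiff.2 ⟨hi, hiF⟩)
          rw [← hb] at this
          exact hij (this.trans hbj)
    have h2 : Disjoint (F.filter (· ≤ j)) (T.filter (¬ · ≤ j)) := by
      rw [Finset.disjoint_left]
      intro i hi hi'
      exact (Finset.mem_filter.1 hi').2 (Finset.mem_filter.1 hi).2
    rw [h1, Finset.card_union_of_disjoint h2]
    have h3 := card_filter_le_add_card_filter_not_le T j
    have h4 : (T.filter (¬ · ≤ j)).card + (S.filter (· ≤ j)).card = S.card := by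
      rw [← hT.1, ← h3, htight]; ring
    have h5 : ((T.filter (¬ · ≤ j)).card : ℝ) + (S.filter (· ≤ j)).card = S.card := by
      exact_mod_cast h4
    have h6 := Finset.sum_filter_add_sum_filter_not F (· ≤ j) x
    have h7 := Finset.sum_filter_add_sum_filter_not Finset.univ (· ≤ j) x
    have h8 : ∑ i ∈ F.filter (¬ · ≤ j), x i ≤ ∑ i ∈ Finset.univ.filter (¬ · ≤ j), x i :=
      Finset.sum_le_sum_of_subset_of_nonneg (Finset.filter_subset_filter _ (Finset.subset_univ _))
        fun i _ _ => (h01 i).1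
    have h9 := hsub (F.filter (· ≤ j))
    have h10 := hx j
    push_cast
    linarith

/-! ### Euler characteristic of compact convex sets -/

open Classical in
-- For a nonempty compact interval, the value of the indicator at t minus its value just to the
-- right of t is 1 exactly at the right endpoint. Applying this difference to the relation and
-- summing over all right endpoints counts each nonempty interval once.
theorem sum_nonempty_eq_zero_real {ι : Type*} (s : Finset ι) (c : ι → ℤ) (I : ι → Set ℝ)
    (hI : ∀ i, IsCompact (I i)) (hI' : ∀ i, Convex ℝ (I i))
    (h : ∀ t, ∑ i ∈ s, (if t ∈ I i then c i else 0) = 0) :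
    ∑ i ∈ s, (if (I i).Nonempty then c i else 0) = 0 := by
  rw [← Finset.sum_filter]
  set s' := s.filter fun i => (I i).Nonempty with hs'
  have hne : ∀ i ∈ s', (I i).Nonempty := fun i hi => (Finset.mem_filter.1 hi).2
  have hb : ∀ i ∈ s', sSup (I i) ∈ I i := fun i hi => (hI i).sSup_mem (hne i hi)
  have hle : ∀ i, ∀ t ∈ I i, t ≤ sSup (I i) := fun i t ht => le_csSup (hI i).bddAbove ht
  have h' : ∀ t, ∑ i ∈ s', (if t ∈ I i then c i else 0) = 0 := by
    intro t
    refine Eq.trans (Finset.sum_subset (Finset.filter_subset _ s) fun i hi hi' => ?_) (h t)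
    rw [if_neg]
    intro ht
    exact hi' (Finset.mem_filter.2 ⟨hi, ⟨t, ht⟩⟩)
  have key : ∀ t, ∑ i ∈ s', (if sSup (I i) = t then c i else 0) = 0 := by
    intro t
    have hev : ∀ i ∈ s', ∀ᶠ u in nhdsWithin t (Set.Ioi t),
        (if sSup (I i) = t then c i else 0) =
          (if t ∈ I i then c i else 0) - (if u ∈ I i then c i else 0) := by
      intro i hi
      by_cases ht : t ∈ I i
      · rcases (hle i t ht).lt_or_eq with hlt | heq
        · filter_upwards [Ioo_mem_nhdsGT hlt] with u hu
          have : u ∈ I i := (hI' i).ordConnected.out ht (hb i hi) ⟨hu.1.le, hu.2.le⟩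
          simp [ht, this, hlt.ne']
        · filter_upwards [self_mem_nhdsWithin] with u hu
          have : u ∉ I i := fun h => absurd (hle i u h) (by rw [← heq]; exact not_le.2 hu)
          simp [ht, this, heq.symm]
      · have hne : sSup (I i) ≠ t := fun h => ht (h ▸ hb i hi)
        have : ∀ᶠ u in nhdsWithin t (Set.Ioi t), u ∉ I i :=
          nhdsWithin_le_nhds ((hI i).isClosed.isOpen_compl.mem_nhds ht)
        filter_upwards [this] with u hu
        simp [ht, hu, hne]
    have := (Filter.eventually_all_finset s').2 hev
    obtain ⟨u, hu⟩ := this.exists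
    rw [Finset.sum_congr rfl hu, Finset.sum_sub_distrib, h', h', sub_zero]
  rw [← Finset.sum_fiberwise_of_maps_to (g := fun i => sSup (I i)) (t := s'.image _)
    fun i hi => Finset.mem_image_of_mem _ hi]
  refine Finset.sum_eq_zero fun t _ => ?_
  rw [Finset.sum_filter]
  exact key t

open Classical in
/-- A linear relation between indicator functions of compact convex sets is respected by the
functional that counts the nonempty ones. -/
theorem sum_nonempty_eq_zero {ι : Type*} (s : Finset ι) (c : ι → ℤ) : ∀ {m : ℕ}
    (P : ι → Set (Fin m → ℝ)), (∀ i, IsCompact (P i)) → (∀ i, Convex ℝ (P i)) →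
    (∀ x, ∑ i ∈ s, (if x ∈ P i then c i else 0) = 0) →
    ∑ i ∈ s, (if (P i).Nonempty then c i else 0) = 0 := by
  intro m
  induction m with
  | zero =>
    intro P _ _ h
    refine Eq.trans (Finset.sum_congr rfl fun i _ => ?_) (h default)
    have : (P i).Nonempty ↔ default ∈ P i :=
      ⟨fun ⟨x, hx⟩ => Subsingleton.elim x default ▸ hx, fun h => ⟨_, h⟩⟩
    simp only [this]
  | succ m ih =>
    intro P hP hP' h
    -- The induction hypothesis on the slice over t shows that the projections to the first
    -- coordinate satisfy the relation at t; the one-dimensional case finishes.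
    have hslice : ∀ t : ℝ, ∑ i ∈ s,
        (if t ∈ (fun x : Fin (m + 1) → ℝ => x 0) '' P i then c i else 0) = 0 := by
      intro t
      have := ih (fun i => {y | (Fin.cons t y : Fin (m + 1) → ℝ) ∈ P i})
        (fun i => by
          have hcl : Topology.IsClosedEmbedding
              (fun y : Fin m → ℝ => (Fin.cons t y : Fin (m + 1) → ℝ)) := by
            have hl : Function.LeftInverse (fun x : Fin (m + 1) → ℝ => (Fin.tail x : Fin m → ℝ))
                (fun y : Fin m → ℝ => (Fin.cons t y : Fin (m + 1) → ℝ)) :=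
              fun y => Fin.tail_cons (α := fun _ => ℝ) _ _
            exact hl.isClosedEmbedding (by unfold Fin.tail; fun_prop)
              (continuous_const.finCons continuous_id)
          exact hcl.isCompact_preimage (hP i))
        (fun i => by
          intro y hy z hz a b ha hb hab
          have := hP' i hy hz ha hb hab
          simp only [Set.mem_ofPred_eq]
          convert this using 1
          ext j
          refine Fin.cases ?_ (fun j => ?_) j
          · simp [← add_mul, hab]
          · simp)
        (fun y => h _)
      refine Eq.trans (Finset.sum_congr rfl fun i _ => ?_) this
      have : t ∈ (fun x : Fin (m + 1) → ℝ => x 0) '' P i ↔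
          {y | (Fin.cons t y : Fin (m + 1) → ℝ) ∈ P i}.Nonempty := by
        constructor
        · rintro ⟨x, hx, rfl⟩
          exact ⟨Fin.tail x, by simpa using hx⟩
        · rintro ⟨y, hy⟩
          exact ⟨_, hy, by simp⟩
      simp only [this]
    have := sum_nonempty_eq_zero_real s c (fun i => (fun x : Fin (m + 1) → ℝ => x 0) '' P i)
      (fun i => (hP i).image (continuous_apply 0))
      (fun i => (hP' i).is_linear_image (f := fun x : Fin (m + 1) → ℝ => x 0)
        ⟨fun _ _ => rfl, fun _ _ => rfl⟩) hslice
    simpa only [Set.image_nonempty] using this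

/-! ### Linear independence of the polytopes of labeled Schubert matroids -/

/-- The binary code of a finite set. -/
def binCode (T : Finset (Fin m)) : ℕ := ∑ i ∈ T, 2 ^ (i : ℕ)

theorem binCode_injective : Function.Injective (binCode : Finset (Fin m) → ℕ) := by
  intro T T' h
  have : (fun s : Finset ℕ => ∑ i ∈ s, 2 ^ i) (T.map Fin.valEmbedding) =
      (fun s : Finset ℕ => ∑ i ∈ s, 2 ^ i) (T'.map Fin.valEmbedding) := by
    simpa [binCode] using h
  exact Finset.map_injective _ (Finset.geomSum_injective le_rfl this)

/-- Makes the binary code a linear extension of the Gale order, realized by a linear functional on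
the polytopes. -/
theorem GaleLE.binCode_le {S T : Finset (Fin m)} (h : GaleLE T S) : binCode T ≤ binCode S := by
  have key : ∀ (A : Finset (Fin m)) (hA : A.card = S.card),
      binCode A = ∑ l : Fin S.card, 2 ^ (A.orderEmbOfFin hA l : ℕ) := by
    intro A hA
    have := Finset.sum_map Finset.univ (A.orderEmbOfFin hA).toEmbedding (fun i => 2 ^ (i : ℕ))
    rwa [Finset.map_orderEmbOfFin_univ] at this
  rw [key T h.1, key S rfl]
  refine Finset.sum_le_sum fun l _ => Nat.pow_le_pow_right two_pos ?_
  exact (galeLE_iff h.1 rfl).1 h l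

/-- Every matroid has a basis that is largest in the Gale order. -/
theorem exists_gale_max_base {M : Matroid (Fin m)} (hM : IsMatroidOfRank k M) :
    ∃ B : Finset (Fin m), M.IsBase B ∧ ∀ T : Finset (Fin m), M.IsBase T → GaleLE T B := by
  -- The j-th set consists of the j largest elements of [m]. A base greedy for final segments has
  -- the most elements in each of them, hence the fewest in each initial segment.
  obtain ⟨B, hB, hBX⟩ := exists_greedy_base hM.1
    (fun j => Finset.univ.filter fun a : Fin m => m < a + 1 + j)
    (fun a b hab i hi => by
      simp only [Finset.mem_filter, Finset.mem_univ, true_and] at hi ⊢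
      omega)
  refine ⟨B, hB, fun T hT => ⟨by rw [card_eq_of_isBase hM hB, card_eq_of_isBase hM hT],
    fun j => ?_⟩⟩
  have h1 := card_inter_le_natRk hT (Finset.univ.filter fun a : Fin m => m < a + 1 + (m - 1 - j))
  rw [← hBX, Finset.inter_filter, Finset.inter_filter, Finset.inter_univ, Finset.inter_univ] at h1
  have h2 : ∀ A : Finset (Fin m), (A.filter fun a : Fin m => m < a + 1 + (m - 1 - j)) =
      A.filter (¬ · ≤ j) := by
    intro A
    refine Finset.filter_congr fun a _ => ?_
    rw [Fin.le_def]
    omega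
  rw [h2, h2] at h1
  have h3 := card_filter_le_add_card_filter_not_le T j
  have h4 := card_filter_le_add_card_filter_not_le B j
  rw [card_eq_of_isBase hM hB] at h4
  rw [card_eq_of_isBase hM hT] at h3
  omega

/-- The linear functional that reads off the binary code of a relabeled basis. -/
noncomputable def codeFunctional (σ : Equiv.Perm (Fin m)) (x : Fin m → ℝ) : ℝ :=
  ∑ i, (2 : ℝ) ^ (σ.symm i : ℕ) * x i

theorem codeFunctional_indVec (σ : Equiv.Perm (Fin m)) (B : Finset (Fin m)) :
    codeFunctional σ (indVec B) = binCode (B.map σ.symm.toEmbedding) := by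
  classical
  simp [codeFunctional, binCode, indVec, Set.indicator_apply]

/-- The functional is integral at the vertices, so if every base has code below t, it is at most t -
1 on the whole polytope. -/
theorem nonempty_inter_codeFunctional_ge {M : Matroid (Fin m)} (σ : Equiv.Perm (Fin m)) (t : ℕ) :
    (matroidPolytope M ∩ {x | (t : ℝ) ≤ codeFunctional σ x}).Nonempty ↔
      ∃ B : Finset (Fin m), M.IsBase B ∧ t ≤ binCode (B.map σ.symm.toEmbedding) := by
  constructor
  · rintro ⟨x, hx, hxt⟩
    by_contra hcon
    push Not at hcon
    have : codeFunctional σ x ≤ (t : ℝ) - 1 := by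
      refine sum_le_of_mem_matroidPolytope hx fun B hB => ?_
      have h1 := codeFunctional_indVec σ B
      unfold codeFunctional at h1
      rw [h1, le_sub_iff_add_le]
      exact_mod_cast hcon B hB
    simp only [Set.mem_ofPred_eq] at hxt
    linarith
  · rintro ⟨B, hB, ht⟩
    refine ⟨indVec B, indVec_mem_matroidPolytope hB, ?_⟩
    simp only [Set.mem_ofPred_eq, codeFunctional_indVec]
    exact_mod_cast ht

theorem LabeledSchubert.isMatroidOfRank (N : LabeledSchubert k m) : IsMatroidOfRank k N.1 := by
  obtain ⟨S, hS, σ, hN⟩ := N.2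
  rw [hN]
  exact (isMatroidOfRank_schubertMatroid hS).mapEquiv σ

theorem map_symm_map (σ : Equiv.Perm (Fin m)) (B : Finset (Fin m)) :
    (B.map σ.symm.toEmbedding).map σ.toEmbedding = B := by
  ext; simp

theorem isBase_mapEquiv_symm_image {M : Matroid (Fin m)} (σ : Equiv.Perm (Fin m))
    {B : Finset (Fin m)} :
    (M.mapEquiv σ).IsBase B ↔ M.IsBase (B.map σ.symm.toEmbedding : Finset (Fin m)) := by
  have := isBase_mapEquiv_image (M := M) σ (B := B.map σ.symm.toEmbedding)
  rwa [map_symm_map] at this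

open Classical in
-- Counting nonempty intersections with the half-spaces at thresholds t and t + 1 and subtracting
-- leaves the matroids whose largest code is exactly t. In the order of a Schubert matroid relabeled
-- from S, with t the code of S, these have Gale-largest base S, so their bases are among those of
-- that Schubert matroid; choosing it with a minimal set of bases leaves it alone.
theorem sum_indicator_eq_zero_imp (d : LabeledSchubert k m →₀ ℤ)
    (hd : ∀ x : Fin m → ℝ,
      (d.sum fun N a => a * (matroidPolytope N.1).indicator (fun _ => (1 : ℤ)) x) = 0) :
    d = 0 := by
  by_contra hne
  have hval : ∀ (σ : Equiv.Perm (Fin m)) (t : ℕ), ∑ N ∈ d.support,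
      (if ∃ B : Finset (Fin m), N.1.IsBase B ∧ t ≤ binCode (B.map σ.symm.toEmbedding)
        then d N else 0) = 0 := by
    intro σ t
    have hclosed : IsClosed {x : Fin m → ℝ | (t : ℝ) ≤ codeFunctional σ x} :=
      isClosed_le continuous_const (by unfold codeFunctional; fun_prop)
    have hconv : Convex ℝ {x : Fin m → ℝ | (t : ℝ) ≤ codeFunctional σ x} :=
      convex_halfSpace_ge (f := codeFunctional σ)
        ⟨fun x y => by simp [codeFunctional, mul_add, Finset.sum_add_distrib],
         fun c x => by simp [codeFunctional, Finset.mul_sum, mul_left_comm]⟩ _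
    have := sum_nonempty_eq_zero d.support d
      (fun N => matroidPolytope N.1 ∩ {x | (t : ℝ) ≤ codeFunctional σ x})
      (fun N => (isCompact_matroidPolytope _).inter_right hclosed)
      (fun N => (convex_matroidPolytope _).inter hconv)
      (fun x => by
        by_cases hx : (t : ℝ) ≤ codeFunctional σ x
        · refine Eq.trans (Finset.sum_congr rfl fun N _ => ?_) (hd x)
          simp [Set.indicator_apply, hx]
        · simp [hx])
    simpa only [nonempty_inter_codeFunctional_ge] using this
  obtain ⟨N₀, hN₀, hmin⟩ := d.support.exists_minimalFor
    (fun N => {B : Finset (Fin m) | N.1.IsBase B}) (Finsupp.support_nonempty_iff.2 hne)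
  obtain ⟨S, hS, σ, hNS⟩ := id N₀.2
  have hbase₀ : ∀ B : Finset (Fin m), N₀.1.IsBase B ↔ GaleLE (B.map σ.symm.toEmbedding) S := by
    intro B
    rw [hNS, isBase_mapEquiv_symm_image, isBase_schubertMatroid]
  have h1 := hval σ (binCode S)
  have h2 := hval σ (binCode S + 1)
  -- The difference of the thresholds `binCode S` and `binCode S + 1` retains only N₀, so its
  -- coefficient vanishes.
  have h3 : ∑ N ∈ d.support, (if N = N₀ then d N else 0) = 0 := by
    refine Eq.trans ?_ (congrArg₂ (· - ·) h1 h2)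
    rw [← Finset.sum_sub_distrib]
    refine Finset.sum_congr rfl fun N hN => ?_
    by_cases heq : N = N₀
    · subst heq
      rw [if_pos rfl, if_pos, if_neg, sub_zero]
      · rintro ⟨B, hB, hlt⟩
        have := ((hbase₀ B).1 hB).binCode_le
        omega
      · have hSS : (S.map σ.toEmbedding).map σ.symm.toEmbedding = S := by ext; simp
        exact ⟨S.map σ.toEmbedding, (hbase₀ _).2 (hSS.symm ▸ GaleLE.refl S), by rw [hSS]⟩
    · rw [if_neg heq]
      by_cases hS1 : ∃ B : Finset (Fin m), N.1.IsBase B ∧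
          binCode S + 1 ≤ binCode (B.map σ.symm.toEmbedding)
      · have hS0 : ∃ B : Finset (Fin m), N.1.IsBase B ∧
            binCode S ≤ binCode (B.map σ.symm.toEmbedding) := by
          obtain ⟨B, hB, h⟩ := hS1
          exact ⟨B, hB, by omega⟩
        rw [if_pos hS1, if_pos hS0, sub_self]
      · rw [if_neg hS1, if_neg, sub_zero]
        rintro ⟨B, hB, hle⟩
        have hN' := N.isMatroidOfRank.mapEquiv σ.symm
        obtain ⟨B', hB', hmax⟩ := exists_gale_max_base hN'
        have htr : ∀ T : Finset (Fin m), N.1.IsBase T ↔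
            (N.1.mapEquiv σ.symm).IsBase (T.map σ.symm.toEmbedding : Finset (Fin m)) :=
          fun T => (isBase_mapEquiv_image σ.symm).symm
        have hB'S : B' = S := by
          apply binCode_injective
          have hle' := (hmax _ ((htr B).1 hB)).binCode_le
          have hlt : ¬ (binCode S + 1 ≤ binCode B') := by
            intro h
            refine hS1 ⟨B'.map σ.toEmbedding, ?_, ?_⟩
            · rw [htr]
              have : (B'.map σ.toEmbedding).map σ.symm.toEmbedding = B' := by ext; simp
              rwa [this]
            · have : (B'.map σ.toEmbedding).map σ.symm.toEmbedding = B' := by ext; simp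
              rwa [this]
          omega
        have hsub : {B : Finset (Fin m) | N.1.IsBase B} ⊆
            {B : Finset (Fin m) | N₀.1.IsBase B} := by
          intro T hT
          exact (hbase₀ T).2 (hB'S ▸ hmax _ ((htr T).1 hT))
        have hsup := hmin hN hsub
        refine heq (Subtype.ext (Matroid.ext_isBase ?_ ?_))
        · rw [N.isMatroidOfRank.1, N₀.isMatroidOfRank.1]
        · intro T _
          have := Set.Subset.antisymm hsub hsup
          have hT := Set.ext_iff.1 this T.toFinset
          simpa using hT
  rw [Finset.sum_ite_eq' d.support N₀, if_pos hN₀] at h3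
  exact Finsupp.mem_support_iff.1 hN₀ h3

/-! ### Existence of Schubert expansions -/

/-- The order complex of a set family with a conical contraction `G ≥ G ∩ F ≤ F` has vanishing
reduced Euler characteristic. -/
theorem sum_chains_neg_one_pow_eq_zero {α : Type*} [DecidableEq α] (V : Finset (Finset α))
    (F : Finset α) (hF : F ∈ V) (hV : ∀ G ∈ V, G ∩ F ∈ V)
    [DecidablePred fun D : Finset (Finset α) => IsChain (· ⊆ ·) (D : Set (Finset α))] :
    ∑ D ∈ V.powerset.filter (fun D : Finset (Finset α) => IsChain (· ⊆ ·) (D : Set (Finset α))),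
      (-1 : ℤ) ^ D.card = 0 := by
  classical
  -- The sign-reversing involution toggles e D: the smallest member of the chain not inside F,
  -- intersected with F, or F itself if there is none. It is comparable to all of D. It depends only
  -- on members not inside F while lying inside F itself, so toggling it does not change it.
  set e : Finset (Finset α) → Finset α := fun D =>
    if h : (D.filter fun G => ¬ G ⊆ F).Nonempty then
      ((D.filter fun G => ¬ G ⊆ F).inf' h id) ∩ F else F with he
  have he_le : ∀ D, e D ⊆ F := by
    intro D
    simp only [he]
    split_ifs
    · exact Finset.inter_subset_right
    · exact subset_rfl
  have he_congr : ∀ D D' : Finset (Finset α),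
      (D.filter fun G => ¬ G ⊆ F) = (D'.filter fun G => ¬ G ⊆ F) → e D = e D' := by
    intro D D' h
    simp only [he, h]
  have he_erase : ∀ D, e (D.erase (e D)) = e D := by
    intro D
    apply he_congr
    ext G
    simp only [Finset.mem_filter, Finset.mem_erase]
    exact ⟨fun h => ⟨h.1.2, h.2⟩, fun h => ⟨⟨fun hG => h.2 (hG ▸ he_le D), h.1⟩, h.2⟩⟩
  have he_insert : ∀ D, e (insert (e D) D) = e D := by
    intro D
    apply he_congr
    rw [Finset.filter_insert, if_neg (not_not.2 (he_le D))]
  have hinf : ∀ (D : Finset (Finset α)), IsChain (· ⊆ ·) (D : Set (Finset α)) →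
      ∀ h : (D.filter fun G => ¬ G ⊆ F).Nonempty,
      (D.filter fun G => ¬ G ⊆ F).inf' h id ∈ D.filter fun G => ¬ G ⊆ F := by
    intro D hD h
    refine Finset.inf'_mem {G | G ∈ D.filter fun G => ¬ G ⊆ F} ?_ _ _ id (fun i hi => hi)
    intro x hx y hy
    have hx' : x ∈ D := (Finset.mem_filter.1 hx).1
    have hy' : y ∈ D := (Finset.mem_filter.1 hy).1
    rcases hD.total hx' hy' with hxy | hxy
    · have : x ⊓ y = x := inf_eq_left.2 hxy
      rwa [this]
    · have : x ⊓ y = y := inf_eq_right.2 hxy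
      rwa [this]
  have he_mem : ∀ D ⊆ V, IsChain (· ⊆ ·) (D : Set (Finset α)) → e D ∈ V := by
    intro D hDV hD
    by_cases h : (D.filter fun G => ¬ G ⊆ F).Nonempty
    · simp only [he, h, dif_pos]
      exact hV _ (hDV (Finset.mem_filter.1 (hinf D hD h)).1)
    · simpa only [he, h, dif_neg, not_false_iff] using hF
  have he_chain : ∀ D : Finset (Finset α), IsChain (· ⊆ ·) (D : Set (Finset α)) →
      IsChain (· ⊆ ·) ((insert (e D) D : Finset (Finset α)) : Set (Finset α)) := by
    intro D hD
    rw [Finset.coe_insert]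
    refine hD.insert fun G hG _ => ?_
    by_cases h : (D.filter fun G => ¬ G ⊆ F).Nonempty
    · simp only [he, h, dif_pos]
      have hmem := hinf D hD h
      set I := (D.filter fun G => ¬ G ⊆ F).inf' h id
      by_cases hGF : G ⊆ F
      · right
        refine Finset.subset_inter ?_ hGF
        rcases hD.total hG (Finset.mem_filter.1 hmem).1 with h1 | h1
        · exact h1
        · exact absurd (h1.trans hGF) (Finset.mem_filter.1 hmem).2
      · left
        refine Finset.inter_subset_left.trans ?_
        exact Finset.inf'_le (f := id) (Finset.mem_filter.2 ⟨hG, hGF⟩)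
    · right
      simp only [he, h, dif_neg, not_false_iff]
      by_contra hGF
      exact h ⟨G, Finset.mem_filter.2 ⟨hG, hGF⟩⟩
  refine Finset.sum_involution
    (fun D _ => if e D ∈ D then D.erase (e D) else insert (e D) D) ?_ ?_ ?_ ?_
  · intro D _
    split_ifs with h
    · have := Finset.card_erase_add_one h
      rw [← this, pow_succ]; ring
    · rw [Finset.card_insert_of_notMem h, pow_succ]; ring
  · intro D _ _
    split_ifs with h
    · intro hD
      rw [← hD] at h
      simp [he_erase] at h
    · intro hD
      have := Finset.mem_insert_self (e D) D
      rw [hD] at this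
      exact h this
  · intro D hD
    simp only [Finset.mem_filter, Finset.mem_powerset] at hD ⊢
    split_ifs with h
    · exact ⟨(Finset.erase_subset _ _).trans hD.1,
        hD.2.mono (by simp)⟩
    · exact ⟨Finset.insert_subset (he_mem D hD.1 hD.2) hD.1, he_chain D hD.2⟩
  · intro D _
    by_cases h : e D ∈ D
    · simp [h, he_erase, Finset.insert_erase]
    · simp [h, he_insert]

/-- The polytope cut out by the rank inequalities of an increasing sequence of sets is the polytope
of a labeled Schubert matroid. -/
theorem exists_labeledSchubert_of_monotone {M : Matroid (Fin m)} (hM : IsMatroidOfRank k M)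
    (X : ℕ → Finset (Fin m)) (hX : Monotone X) (hX0 : X 0 = ∅) (hXm : X m = Finset.univ) :
    ∃ N : LabeledSchubert k m, ∀ x : Fin m → ℝ, x ∈ matroidPolytope N.1 ↔
      (∀ i, 0 ≤ x i ∧ x i ≤ 1) ∧ ∑ i, x i = k ∧ ∀ s, ∑ i ∈ X s, x i ≤ natRk M (X s) := by
  classical
  obtain ⟨B, hB, hBX⟩ := exists_greedy_base hM.1 X hX
  have hBk := card_eq_of_isBase hM hB
  have hex : ∀ b, ∃ s, b ∈ X s := fun b => ⟨m, by simp [hXm]⟩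
  set c : Fin m → ℕ := fun b => Nat.find (hex b) with hc
  have hcX : ∀ b s, b ∈ X s ↔ c b ≤ s := fun b s =>
    ⟨fun h => Nat.find_min' (hex b) h, fun h => hX h (Nat.find_spec (hex b))⟩
  have hc0 : ∀ b, 1 ≤ c b := by
    intro b
    by_contra h
    have : b ∈ X 0 := (hcX b 0).2 (by omega)
    simp [hX0] at this
  -- Elements are ranked by the step at which they enter X; within a step those of the greedy base B
  -- come first, and the factor 2 gives the step priority. As σ sorts by decreasing key, the final
  -- segments of positions, Y j below, hold elements of smallest key.
  set key : Fin m → ℕ := fun b => 2 * c b + if b ∈ B then 0 else 1 with hkey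
  set σ : Equiv.Perm (Fin m) := Tuple.sort (fun b => OrderDual.toDual (key b)) with hσ
  have hanti : ∀ i j, i ≤ j → key (σ j) ≤ key (σ i) := fun i j hij =>
    Tuple.monotone_sort (fun b => OrderDual.toDual (key b)) hij
  set S := B.map σ.symm.toEmbedding with hS
  have hSk : S.card = k := by rw [hS, Finset.card_map, hBk]
  refine ⟨⟨(schubertMatroid S).mapEquiv σ, S, hSk, σ, rfl⟩, fun x => ?_⟩
  rw [mem_matroidPolytope_mapEquiv, mem_matroidPolytope_schubertMatroid, hSk]
  have hbox : (∀ i, 0 ≤ (x ∘ σ) i ∧ (x ∘ σ) i ≤ 1) ↔ ∀ i, 0 ≤ x i ∧ x i ≤ 1 :=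
    ⟨fun h i => by simpa using h (σ.symm i), fun h i => h _⟩
  rw [hbox]
  have hsum : ∑ i, (x ∘ σ) i = ∑ i, x i := Equiv.sum_comp σ x
  rw [hsum]
  refine and_congr_right fun h01 => and_congr_right fun hk => ?_
  set Y : Fin m → Finset (Fin m) := fun j => Finset.univ.filter fun a => ¬ σ.symm a ≤ j with hY
  have hconv : ∀ j, (((S.filter (· ≤ j)).card : ℝ) ≤
      ∑ i ∈ Finset.univ.filter (· ≤ j), (x ∘ σ) i ↔ ∑ a ∈ Y j, x a ≤ (B ∩ Y j).card) := by
    intro j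
    have h1 : (S.filter (· ≤ j)).card = (B.filter fun a => σ.symm a ≤ j).card := by
      rw [hS, Finset.filter_map, Finset.card_map]
      rfl
    have h2 : ∑ i ∈ Finset.univ.filter (· ≤ j), (x ∘ σ) i =
        ∑ a ∈ Finset.univ.filter (fun a => σ.symm a ≤ j), x a := by
      rw [Finset.sum_filter, Finset.sum_filter, ← Equiv.sum_comp σ.symm]
      simp
    have h3 := Finset.sum_filter_add_sum_filter_not Finset.univ (fun a => σ.symm a ≤ j) x
    have h4 := Finset.card_filter_add_card_filter_not (s := B) (fun a => σ.symm a ≤ j)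
    have h5 : B ∩ Y j = B.filter fun a => ¬ σ.symm a ≤ j := by
      rw [hY, Finset.inter_filter, Finset.inter_univ]
    have h6 : ((B.filter fun a => σ.symm a ≤ j).card : ℝ) +
        (B.filter fun a => ¬ σ.symm a ≤ j).card = k := by
      rw [← hBk]; exact_mod_cast h4
    rw [h1, h2, h5, hY]
    constructor <;> intro h <;> linarith
  simp only [hconv]
  have hkeyY : ∀ j b, b ∈ Y j → key b ≤ key (σ j) := by
    intro j b hb
    simp only [hY, Finset.mem_filter, Finset.mem_univ, true_and, not_le] at hb
    simpa using hanti _ _ hb.le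
  have hkeyY' : ∀ j b, b ∉ Y j → key (σ j) ≤ key b := by
    intro j b hb
    simp only [hY, Finset.mem_filter, Finset.mem_univ, true_and, not_not] at hb
    simpa using hanti _ _ hb
  constructor
  · intro h s
    rcases eq_or_ne (X s) Finset.univ with hu | hu
    · rw [← hBX, hu, Finset.inter_univ, hBk, hk]
    · obtain ⟨a, ha⟩ : ∃ a, a ∉ X s := by
        by_contra hcon
        push Not at hcon
        exact hu (Finset.eq_univ_of_forall hcon)
      -- A proper X s is exactly what follows the last position j whose element is outside X s, so
      -- its inequality is one of the Schubert inequalities.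
      obtain ⟨j, hj, hmax⟩ := Finset.exists_max_image
        (Finset.univ.filter fun j : Fin m => σ j ∉ X s) id
        ⟨σ.symm a, by simpa using ha⟩
      simp only [Finset.mem_filter, Finset.mem_univ, true_and, id] at hj hmax
      have hXY : X s = Y j := by
        ext b
        constructor
        · intro hb
          by_contra hbY
          have h1 := hkeyY' j b hbY
          rw [hcX] at hj hb
          simp only [hkey] at h1
          split_ifs at h1 <;> omega
        · intro hb
          by_contra hbX
          simp only [hY, Finset.mem_filter, Finset.mem_univ, true_and] at hb
          exact hb (hmax (σ.symm b) (by simpa using hbX))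
      rw [← hBX, hXY]
      exact h j
  · intro h j
    have hX' : ∀ s, ∑ i ∈ X s, x i ≤ (B ∩ X s).card := fun s => by rw [hBX]; exact h s
    -- Y j ends inside the layer of σ j. If σ j is in B, then Y j exceeds the preceding X only by
    -- elements of B, and x ≤ 1 suffices. Otherwise Y j already contains all of B in this layer, and
    -- x ≥ 0 allows enlarging it to the next X.
    by_cases hjB : σ j ∈ B
    · have hsub : X (c (σ j) - 1) ⊆ Y j := by
        intro b hb
        by_contra hbY
        have h1 := hkeyY' j b hbY
        have h2 := hc0 (σ j)
        rw [hcX] at hb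
        simp only [hkey, hjB, if_true] at h1
        split_ifs at h1 <;> omega
      have hdiff : Y j \ X (c (σ j) - 1) ⊆ B := by
        intro b hb
        rw [Finset.mem_sdiff] at hb
        have h1 := hkeyY j b hb.1
        have h2 := hc0 (σ j)
        rw [hcX] at hb
        by_contra hbB
        simp only [hkey, hjB, hbB, if_true, if_false] at h1
        omega
      have h1 := Finset.sum_sdiff hsub (f := x)
      have h2 : (B ∩ Y j).card = (Y j \ X (c (σ j) - 1)).card + (B ∩ X (c (σ j) - 1)).card := by
        rw [← Finset.card_union_of_disjoint]
        · congr 1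
          ext b
          simp only [Finset.mem_inter, Finset.mem_union, Finset.mem_sdiff]
          constructor
          · rintro ⟨hb, hbY⟩
            by_cases hbX : b ∈ X (c (σ j) - 1)
            · exact Or.inr ⟨hb, hbX⟩
            · exact Or.inl ⟨hbY, hbX⟩
          · rintro (⟨hbY, hbX⟩ | ⟨hb, hbX⟩)
            · exact ⟨hdiff (Finset.mem_sdiff.2 ⟨hbY, hbX⟩), hbY⟩
            · exact ⟨hb, hsub hbX⟩
        · rw [Finset.disjoint_left]
          intro b hb hb'
          exact (Finset.mem_sdiff.1 hb).2 (Finset.mem_inter.1 hb').2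
      have h3 : ∑ i ∈ Y j \ X (c (σ j) - 1), x i ≤ (Y j \ X (c (σ j) - 1)).card := by
        simpa using Finset.sum_le_card_nsmul (Y j \ X (c (σ j) - 1)) x 1 fun i _ => (h01 i).2
      have h4 := hX' (c (σ j) - 1)
      rw [h2]
      push_cast
      linarith
    · have hsub : Y j ⊆ X (c (σ j)) := by
        intro b hb
        have h1 := hkeyY j b hb
        rw [hcX]
        simp only [hkey, hjB, if_false] at h1
        split_ifs at h1 <;> omega
      have hinter : B ∩ X (c (σ j)) ⊆ B ∩ Y j := by
        intro b hb
        rw [Finset.mem_inter] at hb ⊢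
        refine ⟨hb.1, ?_⟩
        by_contra hbY
        have h1 := hkeyY' j b hbY
        have h2 := (hcX _ _).1 hb.2
        simp only [hkey, hjB, hb.1, if_true, if_false] at h1
        omega
      calc ∑ a ∈ Y j, x a ≤ ∑ a ∈ X (c (σ j)), x a :=
            Finset.sum_le_sum_of_subset_of_nonneg hsub fun i _ _ => (h01 i).1
        _ ≤ (B ∩ X (c (σ j))).card := hX' _
        _ ≤ (B ∩ Y j).card := by exact_mod_cast Finset.card_le_card hinter

theorem exists_labeledSchubert_of_isChain {M : Matroid (Fin m)} (hM : IsMatroidOfRank k M)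
    (C : Finset (Finset (Fin m))) (hC : IsChain (· ⊆ ·) (C : Set (Finset (Fin m)))) :
    ∃ N : LabeledSchubert k m, ∀ x : Fin m → ℝ, x ∈ matroidPolytope N.1 ↔
      (∀ i, 0 ≤ x i ∧ x i ≤ 1) ∧ ∑ i, x i = k ∧ ∀ F ∈ C, ∑ i ∈ F, x i ≤ natRk M F := by
  classical
  -- The largest member of the chain with at most s elements, so that F reappears at index `F.card`.
  -- From m on it is the full set, whose inequality is automatic.
  set X : ℕ → Finset (Fin m) := fun s =>
    if m ≤ s then Finset.univ else (C.filter fun F => F.card ≤ s).sup id with hX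
  have hmem : ∀ s < m, X s = ∅ ∨ X s ∈ C := by
    intro s hs
    simp only [hX, not_le.2 hs, if_false]
    rcases (C.filter fun F => F.card ≤ s).eq_empty_or_nonempty with h | h
    · left; simp [h]
    · right
      rw [← Finset.sup'_eq_sup h]
      refine Finset.sup'_mem (C : Set (Finset (Fin m))) ?_ _ _ id
        (fun i hi => (Finset.mem_filter.1 hi).1)
      intro x hx y hy
      rcases hC.total hx hy with hxy | hxy
      · have : x ⊔ y = y := sup_eq_right.2 hxy
        rwa [this]
      · have : x ⊔ y = x := sup_eq_left.2 hxy
        rwa [this]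
  have hcard : ∀ F ∈ C, X F.card = F := by
    intro F hF
    by_cases hm : m ≤ F.card
    · simp only [hX, hm, if_true]
      exact ((Finset.card_eq_iff_eq_univ F).1
        (le_antisymm (by simpa using Finset.card_le_univ F) (by simpa using hm))).symm
    · simp only [hX, hm, if_false]
      refine le_antisymm (Finset.sup_le fun G hG => ?_)
        (Finset.le_sup (f := id) (Finset.mem_filter.2 ⟨hF, le_rfl⟩))
      rw [Finset.mem_filter] at hG
      rcases hC.total hF hG.1 with h | h
      · exact (Finset.eq_of_subset_of_card_le h hG.2).ge
      · exact h
  have hmono : Monotone X := by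
    intro s t hst
    simp only [hX]
    by_cases ht : m ≤ t
    · simp [ht]
    · rw [if_neg ht, if_neg (by omega)]
      exact Finset.sup_mono fun F hF => by
        rw [Finset.mem_filter] at hF ⊢
        exact ⟨hF.1, hF.2.trans hst⟩
  have hX0 : X 0 = ∅ := by
    simp only [hX]
    split_ifs with h
    · obtain rfl : m = 0 := by omega
      exact Subsingleton.elim _ _
    · rw [← Finset.bot_eq_empty, Finset.sup_eq_bot_iff]
      intro F hF
      simpa using (Finset.mem_filter.1 hF).2
  obtain ⟨N, hN⟩ := exists_labeledSchubert_of_monotone hM X hmono hX0 (by simp [hX])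
  refine ⟨N, fun x => (hN x).trans (and_congr_right fun _ => and_congr_right fun hk => ?_)⟩
  constructor
  · intro h F hF
    have := h F.card
    rwa [hcard F hF] at this
  · intro h s
    by_cases hs : m ≤ s
    · obtain ⟨B, hB⟩ := M.exists_isBase
      have h1 := card_inter_le_natRk (B := B.toFinset) (by simpa using hB) Finset.univ
      rw [Finset.inter_univ, card_eq_of_isBase hM (by simpa using hB)] at h1
      simp only [hX, hs, if_true, hk]
      exact_mod_cast h1
    · rcases hmem s (by omega) with h1 | h1
      · simp [h1]
      · exact h _ h1

open Classical in
-- Interchange the sums: for a fixed chain D, the alternating sum over C ⊆ D ∩ A vanishes unless D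
-- misses A.
theorem sum_chains_subset_eq {α : Type*} [Fintype α] [DecidableEq α] (A : Finset (Finset α)) :
    ∑ C : Finset (Finset α), (if IsChain (· ⊆ ·) (C : Set (Finset α)) ∧ C ⊆ A then
      ∑ D : Finset (Finset α), (if IsChain (· ⊆ ·) (D : Set (Finset α)) ∧ C ⊆ D then
        (-1 : ℤ) ^ (D.card + C.card) else 0) else 0) =
    ∑ D ∈ Aᶜ.powerset.filter (fun D : Finset (Finset α) => IsChain (· ⊆ ·) (D : Set (Finset α))),
      (-1 : ℤ) ^ D.card := by
  have h1 : ∀ C : Finset (Finset α),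
      (if IsChain (· ⊆ ·) (C : Set (Finset α)) ∧ C ⊆ A then
      ∑ D : Finset (Finset α), (if IsChain (· ⊆ ·) (D : Set (Finset α)) ∧ C ⊆ D then
        (-1 : ℤ) ^ (D.card + C.card) else 0) else 0) =
      ∑ D : Finset (Finset α), (if IsChain (· ⊆ ·) (D : Set (Finset α)) then
        (if C ∈ (D ∩ A).powerset then (-1 : ℤ) ^ D.card * (-1) ^ C.card else 0) else 0) := by
    intro C
    rw [← Finset.sum_const_zero (s := (Finset.univ : Finset (Finset (Finset α))))]
    rw [← Finset.sum_ite_irrel]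
    refine Finset.sum_congr rfl fun D _ => ?_
    by_cases hD : IsChain (· ⊆ ·) (D : Set (Finset α))
    · by_cases hCD : C ⊆ D
      · have hCc : IsChain (· ⊆ ·) (C : Set (Finset α)) := hD.mono (by simpa using hCD)
        simp only [hD, hCD, hCc, Finset.mem_powerset, Finset.subset_inter_iff, pow_add, true_and,
          if_true, Finset.sum_const_zero]
      · simp only [hD, hCD, Finset.mem_powerset, Finset.subset_inter_iff, false_and, and_false,
          if_false, ite_self, Finset.sum_const_zero]
    · simp [hD]
  rw [Finset.sum_congr rfl fun C _ => h1 C, Finset.sum_comm, Finset.sum_filter]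
  rw [← Finset.sum_subset (Finset.subset_univ Aᶜ.powerset)]
  · refine Finset.sum_congr rfl fun D hD => ?_
    split_ifs with h
    · have : D ∩ A = ∅ := by
        rw [Finset.mem_powerset] at hD
        exact Finset.disjoint_iff_inter_eq_empty.1 (Finset.subset_compl_iff_disjoint_right.1 hD)
      rw [← Finset.sum_filter, Finset.filter_mem_eq_inter, Finset.univ_inter, this]
      simp
    · simp
  · intro D _ hD
    split_ifs with h
    · rw [← Finset.sum_filter, Finset.filter_mem_eq_inter, Finset.univ_inter, ← Finset.mul_sum,
        Finset.sum_powerset_neg_one_pow_card, if_neg, mul_zero]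
      intro hDA
      apply hD
      rw [Finset.mem_powerset]
      exact Finset.subset_compl_iff_disjoint_right.2 (Finset.disjoint_iff_inter_eq_empty.2 hDA)
    · simp

open Classical in
/-- Every matroid has a Schubert expansion. -/
theorem exists_isSchubertExpansion {M : Matroid (Fin m)} (hM : IsMatroidOfRank k M) :
    ∃ c : LabeledSchubert k m →₀ ℤ, IsSchubertExpansion M c := by
  have hN : ∀ C : Finset (Finset (Fin m)), ∃ N : LabeledSchubert k m,
      IsChain (· ⊆ ·) (C : Set (Finset (Fin m))) → ∀ x : Fin m → ℝ, x ∈ matroidPolytope N.1 ↔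
      (∀ i, 0 ≤ x i ∧ x i ≤ 1) ∧ ∑ i, x i = k ∧ ∀ F ∈ C, ∑ i ∈ F, x i ≤ natRk M F := by
    intro C
    by_cases hC : IsChain (· ⊆ ·) (C : Set (Finset (Fin m)))
    · obtain ⟨N, h⟩ := exists_labeledSchubert_of_isChain hM C hC
      exact ⟨N, fun _ => h⟩
    · obtain ⟨N, -⟩ := exists_labeledSchubert_of_isChain hM ∅ (by simp)
      exact ⟨N, fun h => absurd h hC⟩
  choose N hN using hN
  -- Chosen so that, at a point satisfying exactly the inequalities in A, the sum over chains C ⊆ A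
  -- becomes the reduced Euler characteristic, up to sign, of the chains of violated sets: 1 if
  -- nothing is violated, as only the empty chain remains, and otherwise 0.
  set lam : Finset (Finset (Fin m)) → ℤ := fun C =>
    ∑ D : Finset (Finset (Fin m)), (if IsChain (· ⊆ ·) (D : Set (Finset (Fin m))) ∧ C ⊆ D then
        (-1 : ℤ) ^ (D.card + C.card) else 0) with hlam
  refine ⟨∑ C : Finset (Finset (Fin m)),
    if IsChain (· ⊆ ·) (C : Set (Finset (Fin m))) then Finsupp.single (N C) (lam C) else 0,
    fun x => ?_⟩
  rw [← Finsupp.sum_finsetSum_index (by simp) (by intros; ring)]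
  have hterm : ∀ C : Finset (Finset (Fin m)),
      ((if IsChain (· ⊆ ·) (C : Set (Finset (Fin m))) then Finsupp.single (N C) (lam C) else 0 :
        LabeledSchubert k m →₀ ℤ).sum fun N a =>
          a * (matroidPolytope N.1).indicator (fun _ => (1 : ℤ)) x) =
      if IsChain (· ⊆ ·) (C : Set (Finset (Fin m))) then
        (if x ∈ matroidPolytope (N C).1 then lam C else 0) else 0 := by
    intro C
    split_ifs with h1 h2
    · simp [Set.indicator_of_mem h2]
    · simp [Set.indicator_of_notMem h2]
    · simp
  rw [Finset.sum_congr rfl fun C _ => hterm C]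
  by_cases hbox : (∀ i, 0 ≤ x i ∧ x i ≤ 1) ∧ ∑ i, x i = k
  · set A : Finset (Finset (Fin m)) :=
      Finset.univ.filter fun F => ∑ i ∈ F, x i ≤ natRk M F with hA
    have hsum := sum_chains_subset_eq A
    have h1 : ∀ C : Finset (Finset (Fin m)),
        (if IsChain (· ⊆ ·) (C : Set (Finset (Fin m))) then
          (if x ∈ matroidPolytope (N C).1 then lam C else 0) else 0) =
        (if IsChain (· ⊆ ·) (C : Set (Finset (Fin m))) ∧ C ⊆ A then lam C else 0) := by
      intro C
      rw [ite_and]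
      split_ifs with h1 h2 h3 h3
      · rfl
      · refine absurd (fun F hF => ?_) h3
        simpa [hA] using ((hN C h1 x).1 h2).2.2 F hF
      · refine absurd ((hN C h1 x).2 ⟨hbox.1, hbox.2, fun F hF => ?_⟩) h2
        simpa [hA] using h3 hF
      · rfl
      · rfl
    rw [Finset.sum_congr rfl fun C _ => h1 C]
    refine Eq.trans ?_ hsum.symm
    rcases Aᶜ.eq_empty_or_nonempty with hV | hV
    · have hx : x ∈ matroidPolytope M := by
        refine (mem_matroidPolytope_iff hM).2 ⟨hbox.2, fun F => ?_⟩
        have : F ∈ A := by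
          rw [Finset.compl_eq_empty_iff] at hV
          rw [hV]; exact Finset.mem_univ _
        simpa [hA] using this
      rw [Set.indicator_of_mem hx, hV]
      simp [Finset.filter_singleton]
    -- F maximizes the violation. By submodularity the violations of G ∩ F and G ∪ F sum to at least
    -- those of G and F, and that of G ∪ F is at most that of F; so G ∩ F is violated whenever G is,
    -- and the family contracts through F.
    · obtain ⟨F, -, hF⟩ := Finset.exists_max_image (Finset.univ : Finset (Finset (Fin m)))
        (fun F => ∑ i ∈ F, x i - natRk M F) ⟨∅, Finset.mem_univ _⟩
      have hmem : ∀ G : Finset (Fin m), G ∈ Aᶜ ↔ 0 < ∑ i ∈ G, x i - natRk M G := by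
        intro G
        simp [hA]
      obtain ⟨G₀, hG₀⟩ := hV
      have hFV : F ∈ Aᶜ := (hmem F).2 (((hmem G₀).1 hG₀).trans_le (hF G₀ (Finset.mem_univ _)))
      rw [sum_chains_neg_one_pow_eq_zero Aᶜ F hFV]
      · refine Set.indicator_of_notMem (fun hx => ?_) _
        have h2 := ((mem_matroidPolytope_iff hM).1 hx).2 F
        have h3 := (hmem F).1 hFV
        linarith
      · intro G hG
        rw [hmem] at hG ⊢
        have h2 := hF (G ∪ F) (Finset.mem_univ _)
        have h3 := Finset.sum_union_inter (s₁ := G) (s₂ := F) (f := x)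
        have h4 : (natRk M (G ∩ F) : ℝ) + natRk M (G ∪ F) ≤ natRk M G + natRk M F := by
          exact_mod_cast natRk_inter_add_union_le M G F
        linarith
  · have hx : x ∉ matroidPolytope M := fun hx => hbox
      ⟨mem_Icc_of_mem_matroidPolytope hx, sum_eq_of_mem_matroidPolytope hM hx⟩
    rw [Set.indicator_of_notMem hx]
    refine (Finset.sum_eq_zero fun C _ => ?_).symm
    split_ifs with h1 h2
    · exact absurd ⟨((hN C h1 x).1 h2).1, ((hN C h1 x).1 h2).2.1⟩ hbox
    · rfl
    · rfl

/-- Every matroid has exactly one Schubert expansion. -/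
theorem existsUnique_isSchubertExpansion {M : Matroid (Fin m)} (hM : IsMatroidOfRank k M) :
    ∃! c : LabeledSchubert k m →₀ ℤ, IsSchubertExpansion M c := by
  obtain ⟨c, hc⟩ := exists_isSchubertExpansion hM
  refine ⟨c, hc, fun c' hc' => ?_⟩
  rw [← sub_eq_zero]
  refine sum_indicator_eq_zero_imp _ fun x => ?_
  rw [Finsupp.sum_sub_index (by intros; ring), ← hc x, ← hc' x, sub_self]

/-! ### Coordinate vectors -/

theorem isSchubertExpansion_labeledCoord {M : Matroid (Fin m)} (hM : IsMatroidOfRank k M) :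
    IsSchubertExpansion M (labeledCoord k M) := by
  have h := existsUnique_isSchubertExpansion hM
  rw [labeledCoord, dif_pos h]
  exact h.choose_spec.1

theorem labeledCoord_eq {M : Matroid (Fin m)} (hM : IsMatroidOfRank k M)
    {c : LabeledSchubert k m →₀ ℤ} (hc : IsSchubertExpansion M c) : labeledCoord k M = c :=
  (existsUnique_isSchubertExpansion hM).unique (isSchubertExpansion_labeledCoord hM) hc

/-- Equal sums of indicator functions give equal sums of labeled coordinate vectors. -/
theorem sum_labeledCoord_eq {ι κ : Type*} (s : Finset ι) (t : Finset κ)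
    (M : ι → Matroid (Fin m)) (N : κ → Matroid (Fin m)) (hM : ∀ i, IsMatroidOfRank k (M i))
    (hN : ∀ j, IsMatroidOfRank k (N j))
    (h : ∀ x, ∑ i ∈ s, (matroidPolytope (M i)).indicator (fun _ => (1 : ℤ)) x =
      ∑ j ∈ t, (matroidPolytope (N j)).indicator (fun _ => (1 : ℤ)) x) :
    ∑ i ∈ s, labeledCoord k (M i) = ∑ j ∈ t, labeledCoord k (N j) := by
  rw [← sub_eq_zero]
  refine sum_indicator_eq_zero_imp _ fun x => ?_
  rw [Finsupp.sum_sub_index (by intros; ring),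
    ← Finsupp.sum_finsetSum_index (by simp) (by intros; ring),
    ← Finsupp.sum_finsetSum_index (by simp) (by intros; ring),
    ← Finset.sum_congr rfl fun i _ => isSchubertExpansion_labeledCoord (hM i) x,
    ← Finset.sum_congr rfl fun i _ => isSchubertExpansion_labeledCoord (hN i) x, h x, sub_self]

/-- Adding up the coordinates of isomorphic Schubert matroids, as an additive map. -/
noncomputable def classCoord (k m : ℕ) :
    (LabeledSchubert k m →₀ ℤ) →+ (SchubertClass k m → ℝ) where
  toFun c s := ((c.mapDomain (Quotient.mk (schubertSetoid k m)) s : ℤ) : ℝ)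
  map_zero' := by
    funext s
    rw [Finsupp.mapDomain_zero]
    exact Int.cast_zero
  map_add' c d := by
    funext s
    rw [Finsupp.mapDomain_add]
    exact Int.cast_add _ _

theorem sum_coordVec_eq {ι κ : Type*} (s : Finset ι) (t : Finset κ)
    (M : ι → Matroid (Fin m)) (N : κ → Matroid (Fin m)) (hM : ∀ i, IsMatroidOfRank k (M i))
    (hN : ∀ j, IsMatroidOfRank k (N j))
    (h : ∀ x, ∑ i ∈ s, (matroidPolytope (M i)).indicator (fun _ => (1 : ℤ)) x =
      ∑ j ∈ t, (matroidPolytope (N j)).indicator (fun _ => (1 : ℤ)) x) :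
    ∑ i ∈ s, coordVec k (M i) = ∑ j ∈ t, coordVec k (N j) := by
  have h1 := congrArg (classCoord k m) (sum_labeledCoord_eq s t M N hM hN h)
  rwa [map_sum, map_sum] at h1

theorem mapEquiv_trans (M : Matroid (Fin m)) (σ τ : Equiv.Perm (Fin m)) :
    (M.mapEquiv σ).mapEquiv τ = M.mapEquiv (σ.trans τ) :=
  Matroid.ext_isBase (by simp [Set.image_image]) fun B _ => by simp [Set.image_image]

/-- Relabeling a labeled Schubert matroid. -/
noncomputable def LabeledSchubert.relabel (σ : Equiv.Perm (Fin m)) (N : LabeledSchubert k m) :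
    LabeledSchubert k m :=
  ⟨N.1.mapEquiv σ, by
    obtain ⟨S, hS, τ, hN⟩ := N.2
    exact ⟨S, hS, τ.trans σ, by rw [hN, mapEquiv_trans]⟩⟩

theorem indicator_matroidPolytope_mapEquiv (M : Matroid (Fin m)) (σ : Equiv.Perm (Fin m))
    (x : Fin m → ℝ) : (matroidPolytope (M.mapEquiv σ)).indicator (fun _ => (1 : ℤ)) x =
      (matroidPolytope M).indicator (fun _ => (1 : ℤ)) (x ∘ σ) := by
  classical
  simp only [Set.indicator_apply, mem_matroidPolytope_mapEquiv]

theorem labeledCoord_mapEquiv {M : Matroid (Fin m)} (hM : IsMatroidOfRank k M)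
    (σ : Equiv.Perm (Fin m)) : labeledCoord k (M.mapEquiv σ) =
      (labeledCoord k M).mapDomain (LabeledSchubert.relabel σ) := by
  refine labeledCoord_eq (hM.mapEquiv σ) fun x => ?_
  rw [Finsupp.sum_mapDomain_index (by simp) (by intros; ring), indicator_matroidPolytope_mapEquiv,
    isSchubertExpansion_labeledCoord hM]
  refine Finset.sum_congr rfl fun N _ => ?_
  simp only [LabeledSchubert.relabel, indicator_matroidPolytope_mapEquiv]

/-- Isomorphic matroids have the same coordinate vector. -/
theorem coordVec_mapEquiv {M : Matroid (Fin m)} (hM : IsMatroidOfRank k M)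
    (σ : Equiv.Perm (Fin m)) : coordVec k (M.mapEquiv σ) = coordVec k M := by
  have h : Quotient.mk (schubertSetoid k m) ∘ LabeledSchubert.relabel σ =
      Quotient.mk (schubertSetoid k m) := by
    funext N
    exact (Quotient.sound (s := schubertSetoid k m) ⟨σ, rfl⟩ : _).symm
  unfold coordVec
  rw [labeledCoord_mapEquiv hM, ← Finsupp.mapDomain_comp, h]

/-- A Schubert matroid is its own expansion, so coordinate vectors separate nonisomorphic Schubert
matroids. -/
theorem coordVec_labeledSchubert (N : LabeledSchubert k m) :
    coordVec k N.1 = fun q => ((Finsupp.single (Quotient.mk (schubertSetoid k m) N) (1 : ℤ) q : ℤ) : ℝ) := by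
  have : labeledCoord k N.1 = Finsupp.single N 1 :=
    labeledCoord_eq N.isMatroidOfRank fun x => by simp
  unfold coordVec
  rw [this, Finsupp.mapDomain_single]
  rfl

theorem iso_of_coordVec_eq (N N' : LabeledSchubert k m) (h : coordVec k N.1 = coordVec k N'.1) :
    Iso N.1 N'.1 := by
  rw [coordVec_labeledSchubert, coordVec_labeledSchubert] at h
  have h1 := congrFun h (Quotient.mk (schubertSetoid k m) N)
  simp only [Finsupp.single_eq_same, Int.cast_inj] at h1
  by_contra hne
  rw [Finsupp.single_eq_of_ne] at h1
  · exact one_ne_zero h1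
  · intro heq
    exact hne (Quotient.exact (s := schubertSetoid k m) heq)

/-- Makes the coordinate space finite-dimensional and normed, as the argument on relative interiors
requires. -/
instance : Finite (SchubertClass k m) := by
  refine Finite.of_surjective
    (fun S : {S : Finset (Fin m) // S.card = k} => (Quotient.mk (schubertSetoid k m)
      ⟨schubertMatroid S.1, S.1, S.2, (schubertSetoid k m).refl
        ⟨schubertMatroid S.1, S.1, S.2, Equiv.refl _,
          Matroid.ext_isBase (by simp) fun B _ => by simp⟩⟩ : SchubertClass k m)) ?_
  intro q
  induction q using Quotient.inductionOn with
  | _ N =>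
    obtain ⟨S, hS, h⟩ := id N.2
    exact ⟨⟨S, hS⟩, Quotient.sound (s := schubertSetoid k m) h⟩

/-! ### Spitzer's combinatorial lemma for zero-sum vectors -/

/-- All partial sums of a finite sequence are nonnegative. -/
def NonnegPartialSums {n : ℕ} (z : Fin n → ℝ) : Prop :=
  ∀ j : ℕ, 0 ≤ ∑ i : Fin n, (if (i : ℕ) < j then z i else 0)

/-- A vector that is orthogonal to all functions invariant under a permutation; equivalently, its
sum over every cycle vanishes. -/
def BalancedOn {α : Type*} [Fintype α] (τ : Equiv.Perm α) (y : α → ℝ) : Prop :=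
  ∀ g : α → ℝ, (∀ i, g (τ i) = g i) → ∑ i, g i * y i = 0

open Classical in
/-- The number of orderings for which all partial sums are nonnegative. -/
noncomputable def numNonneg (n : ℕ) {α : Type*} [Fintype α] [DecidableEq α] (y : α → ℝ) : ℕ :=
  ∑ ω : Fin n ≃ α, if NonnegPartialSums (y ∘ ω) then 1 else 0

open Classical in
/-- The number of permutations on whose cycles a vector sums to zero. -/
noncomputable def numBalanced {α : Type*} [Fintype α] [DecidableEq α] (y : α → ℝ) : ℕ :=
  ∑ τ : Equiv.Perm α, if BalancedOn τ y then 1 else 0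

theorem numNonneg_comp_equiv {n : ℕ} {α β : Type*} [Fintype α] [Fintype β]
    [DecidableEq α] [DecidableEq β] (e : α ≃ β)
    (y : β → ℝ) : numNonneg n (y ∘ e) = numNonneg n y := by
  classical
  unfold numNonneg
  rw [← Equiv.sum_comp (Equiv.equivCongr (Equiv.refl (Fin n)) e)]
  rfl

theorem numBalanced_comp_equiv {α β : Type*} [Fintype α] [Fintype β]
    [DecidableEq α] [DecidableEq β] (e : α ≃ β)
    (y : β → ℝ) : numBalanced (y ∘ e) = numBalanced y := by
  classical
  unfold numBalanced
  rw [← Equiv.sum_comp (Equiv.permCongr e)]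
  refine Finset.sum_congr rfl fun τ _ => ?_
  have : BalancedOn τ (y ∘ e) ↔ BalancedOn (e.permCongr τ) y := by
    constructor
    · intro h g hg
      rw [← h (g ∘ e) (fun i => by simpa using hg (e i)), ← Equiv.sum_comp e]
      rfl
    · intro h g hg
      rw [← h (g ∘ e.symm) (fun i => by simp [hg]), ← Equiv.sum_comp e]
      simp
  simp only [this]

theorem sum_insertNth_lt {n : ℕ} (p : Fin (n + 1)) (a : ℝ) (z : Fin n → ℝ) (j : ℕ) :
    ∑ i : Fin (n + 1), (if (i : ℕ) < j then (p.insertNth a z : Fin (n + 1) → ℝ) i else 0) =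
      if (p : ℕ) < j then a + ∑ i : Fin n, (if (i : ℕ) < j - 1 then z i else 0)
      else ∑ i : Fin n, (if (i : ℕ) < j then z i else 0) := by
  rw [Fin.sum_univ_succAbove _ p]
  simp only [Fin.insertNth_apply_same, Fin.insertNth_apply_succAbove]
  have h : ∀ i : Fin n, ((p.succAbove i : Fin (n + 1)) : ℕ) =
      if (i : ℕ) < p then (i : ℕ) else i + 1 := by
    intro i
    simp only [Fin.succAbove, Fin.lt_def, Fin.val_castSucc]
    split_ifs <;> simp
  split_ifs with hp
  · congr 1
    refine Finset.sum_congr rfl fun i _ => ?_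
    refine if_congr ?_ rfl rfl
    rw [h]
    split_ifs <;> omega
  · rw [zero_add]
    refine Finset.sum_congr rfl fun i _ => ?_
    refine if_congr ?_ rfl rfl
    rw [h]
    split_ifs <;> omega

/-- Inserting a ≥ 0 right before entry q, instead of adding it to that entry, creates just one new
partial sum: an old one plus a. -/
theorem nonnegPartialSums_insertNth_castSucc {n : ℕ} (q : Fin n) {a : ℝ} (ha : 0 ≤ a)
    (z : Fin n → ℝ) :
    NonnegPartialSums (q.castSucc.insertNth a z : Fin (n + 1) → ℝ) ↔
      NonnegPartialSums (z + Pi.single q a) := by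
  have hR : ∀ j : ℕ, ∑ i : Fin n, (if (i : ℕ) < j then (z + (Pi.single q a : Fin n → ℝ)) i else 0) =
      ∑ i : Fin n, (if (i : ℕ) < j then z i else 0) + if (q : ℕ) < j then a else 0 := by
    intro j
    have : ∀ i : Fin n, (if (i : ℕ) < j then (z + (Pi.single q a : Fin n → ℝ)) i else 0) =
        (if (i : ℕ) < j then z i else 0) + if i = q then (if (q : ℕ) < j then a else 0) else 0 := by
      intro i
      by_cases hi : i = q
      · subst hi; by_cases h : (i : ℕ) < j <;> simp [h]
      · simp [hi]
    rw [Finset.sum_congr rfl fun i _ => this i, Finset.sum_add_distrib]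
    simp
  unfold NonnegPartialSums
  simp only [sum_insertNth_lt, hR, Fin.val_castSucc]
  constructor
  · intro h j
    by_cases hj : (q : ℕ) < j
    · have := h (j + 1)
      rw [if_pos (by omega), Nat.add_sub_cancel] at this
      rw [if_pos hj]; linarith
    · have := h j
      rw [if_neg hj] at this ⊢
      simpa using this
  · intro h j
    split_ifs with hj
    · have := h (j - 1)
      by_cases hj' : (q : ℕ) < j - 1
      · rw [if_pos hj'] at this; linarith
      · rw [if_neg hj'] at this; linarith
    · have := h j
      rw [if_neg hj] at this
      simpa using this

/-- The partial sum just before the last entry is -a, which forces a = 0. -/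
theorem nonnegPartialSums_insertNth_last {n : ℕ} {a : ℝ} (ha : 0 ≤ a)
    (z : Fin n → ℝ) (h0 : a + ∑ i, z i = 0) :
    NonnegPartialSums ((Fin.last n).insertNth a z : Fin (n + 1) → ℝ) ↔
      a = 0 ∧ NonnegPartialSums z := by
  have hfull : ∀ j ≥ n, ∑ i : Fin n, (if (i : ℕ) < j then z i else 0) = ∑ i, z i := fun j hj =>
    Finset.sum_congr rfl fun i _ => if_pos (by omega)
  unfold NonnegPartialSums
  simp only [sum_insertNth_lt, Fin.val_last]
  constructor
  · intro h
    have h1 := h n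
    rw [if_neg (lt_irrefl n), hfull n le_rfl] at h1
    refine ⟨by linarith, fun j => ?_⟩
    by_cases hj : n < j
    · rw [hfull j hj.le]; exact h1
    · have := h j
      rwa [if_neg hj] at this
  · rintro ⟨rfl, h⟩ j
    split_ifs with hj
    · rw [hfull (j - 1) (by omega)]; linarith
    · exact h j

/-- Orderings of `Option α` as an ordering of `α` with an inserted position. -/
theorem bijective_insert_none (n : ℕ) (α : Type*) :
    Function.Bijective (fun q : Fin (n + 1) × (Fin n ≃ α) =>
      (finSuccEquiv' q.1).trans (Equiv.optionCongr q.2)) := by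
  have hnone : ∀ ω : Fin n ≃ α, (Equiv.optionCongr ω).symm none = none := fun ω => by
    rw [Equiv.symm_apply_eq]; simp
  constructor
  · rintro ⟨p, ω⟩ ⟨p', ω'⟩ h
    have hp : p = p' := by
      have h1 := congrArg (fun e : Fin (n + 1) ≃ Option α => e.symm none) h
      simpa [hnone] using h1
    subst hp
    have h2 : ω = ω' := by
      ext i
      have h1 := congrArg (fun e : Fin (n + 1) ≃ Option α => e (p.succAbove i)) h
      simpa using h1
    rw [h2]
  · intro ω
    set p := ω.symm none with hp
    have h0 : ((finSuccEquiv' p).symm.trans ω) none = none := by simp [hp]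
    refine ⟨(p, Equiv.removeNone ((finSuccEquiv' p).symm.trans ω)), ?_⟩
    ext1 i
    rcases Fin.eq_self_or_eq_succAbove p i with rfl | ⟨i, rfl⟩
    · simp [hp]
    · simp only [Equiv.trans_apply, finSuccEquiv'_succAbove, Equiv.optionCongr_apply,
        Option.map_some]
      rw [Equiv.removeNone_some]
      · simp
      · have : ((finSuccEquiv' p).symm.trans ω) (some i) ≠ none := fun h =>
          Option.some_ne_none i (((finSuccEquiv' p).symm.trans ω).injective (h.trans h0.symm))
        exact ⟨_, (Option.some_get (Option.ne_none_iff_isSome.1 this)).symm⟩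

/-- In an ordering, the nonnegative entry at `none` is either last or directly followed by some b,
into which it can be merged. `numBalanced_option` is the same recursion for permutations. -/
theorem numNonneg_option {n : ℕ} {α : Type*} [Fintype α] [DecidableEq α] (y : Option α → ℝ)
    (h0 : 0 ≤ y none) (hy : ∑ i, y i = 0) :
    numNonneg (n + 1) y = (if y none = 0 then numNonneg n (y ∘ some) else 0) +
      ∑ b, numNonneg n (y ∘ some + Pi.single b (y none)) := by
  classical
  unfold numNonneg
  rw [← Equiv.sum_comp (Equiv.ofBijective _ (bijective_insert_none n α))
    (fun ω : Fin (n + 1) ≃ Option α => if NonnegPartialSums (y ∘ ω) then 1 else 0), Fintype.sum_prod_type_right]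
  have hcomp : ∀ (p : Fin (n + 1)) (ω : Fin n ≃ α),
      y ∘ ((finSuccEquiv' p).trans (Equiv.optionCongr ω)) =
        (p.insertNth (y none) (y ∘ some ∘ ω) : Fin (n + 1) → ℝ) := by
    intro p ω
    funext i
    rcases Fin.eq_self_or_eq_succAbove p i with rfl | ⟨i, rfl⟩ <;> simp
  have hsum : ∀ ω : Fin n ≃ α, y none + ∑ i, (y ∘ some ∘ ω) i = 0 := by
    intro ω
    rw [← hy, Fintype.sum_option]
    congr 1
    exact Equiv.sum_comp ω (y ∘ some)
  have hadd : ∀ (ω : Fin n ≃ α) (q : Fin n), y ∘ some ∘ ω + Pi.single q (y none) =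
      (y ∘ some + Pi.single (ω q) (y none)) ∘ ω := by
    intro ω q
    funext i
    by_cases h : i = q
    · subst h; simp
    · simp [h]
  have hstep : ∀ ω : Fin n ≃ α, ∑ p : Fin (n + 1),
      (if NonnegPartialSums (y ∘ ((finSuccEquiv' p).trans (Equiv.optionCongr ω))) then 1 else 0) =
      (if y none = 0 then (if NonnegPartialSums ((y ∘ some) ∘ ω) then 1 else 0) else 0) +
        ∑ b, (if NonnegPartialSums ((y ∘ some + Pi.single b (y none)) ∘ ω) then 1 else 0) := by
    intro ω
    rw [Fin.sum_univ_castSucc, add_comm]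
    congr 1
    · rw [hcomp]
      simp only [nonnegPartialSums_insertNth_last h0 _ (hsum ω), ite_and]
      rfl
    · rw [← Equiv.sum_comp ω]
      refine Finset.sum_congr rfl fun q _ => ?_
      simp only [hcomp, nonnegPartialSums_insertNth_castSucc q h0, hadd]
  simp only [Equiv.ofBijective_apply]
  rw [Finset.sum_congr rfl fun ω _ => hstep ω, Finset.sum_add_distrib, Finset.sum_comm]
  congr 1
  split_ifs <;> simp

theorem balancedOn_decomposeOption_symm_none {α : Type*} [Fintype α] [DecidableEq α]
    (y : Option α → ℝ) (τ : Equiv.Perm α) :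
    BalancedOn (Equiv.Perm.decomposeOption.symm (none, τ)) y ↔
      y none = 0 ∧ BalancedOn τ (y ∘ some) := by
  constructor
  · intro h
    constructor
    · have := h (fun i => if i = none then 1 else 0) (fun i => by cases i <;> simp)
      simpa [Fintype.sum_option] using this
    · intro g hg
      have := h (fun i => i.elim 0 g) (fun i => by cases i <;> simp [hg])
      simpa [Fintype.sum_option] using this
  · rintro ⟨h0, h⟩ g hg
    have := h (g ∘ some) (fun i => by simpa using hg (some i))
    simpa [Fintype.sum_option, h0] using this

/-- In this permutation `none` is spliced into the cycle of b, directly before b, so cycle sums are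
those of τ after merging the entry at `none` into b. -/
theorem balancedOn_decomposeOption_symm_some {α : Type*} [Fintype α] [DecidableEq α]
    (y : Option α → ℝ) (b : α) (τ : Equiv.Perm α) :
    BalancedOn (Equiv.Perm.decomposeOption.symm (some b, τ)) y ↔
      BalancedOn τ (y ∘ some + Pi.single b (y none)) := by
  have hsum : ∀ g : α → ℝ, ∑ i, g i * (y ∘ some + (Pi.single b (y none) : α → ℝ)) i =
      g b * y none + ∑ i, g i * y (some i) := by
    intro g
    simp [mul_add, Finset.sum_add_distrib, Pi.single_apply, add_comm]
  have happ : ∀ i : α, (Equiv.Perm.decomposeOption.symm (some b, τ)) (some i) =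
      if τ i = b then none else some (τ i) := by
    intro i
    simp [Equiv.Perm.decomposeOption_symm_apply, Equiv.swap_apply_def]
  have hnone : (Equiv.Perm.decomposeOption.symm (some b, τ)) none = some b := by
    simp [Equiv.Perm.decomposeOption_symm_apply]
  constructor
  · intro h g hg
    rw [hsum]
    have := h (fun i => i.elim (g b) g) (fun i => by
      cases i with
      | none => rw [hnone]; rfl
      | some i =>
        rw [happ]
        split_ifs with hi
        · simp only [Option.elim]; rw [← hi, hg]
        · simpa using hg i)
    simpa [Fintype.sum_option] using this
  · intro h g hg
    have hb : g (some b) = g none := by rw [← hnone]; exact hg none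
    have := h (g ∘ some) (fun i => by
      have h1 := hg (some i)
      rw [happ] at h1
      split_ifs at h1 with hi
      · simp only [Function.comp]; rw [hi, hb, h1]
      · simpa using h1)
    rw [hsum] at this
    rw [Fintype.sum_option, ← hb]
    exact this

theorem numBalanced_option {α : Type*} [Fintype α] [DecidableEq α] (y : Option α → ℝ) :
    numBalanced y = (if y none = 0 then numBalanced (y ∘ some) else 0) +
      ∑ b, numBalanced (y ∘ some + Pi.single b (y none)) := by
  classical
  unfold numBalanced
  rw [← Equiv.sum_comp Equiv.Perm.decomposeOption.symm, Fintype.sum_prod_type, Fintype.sum_option]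
  congr 1
  · simp only [balancedOn_decomposeOption_symm_none, ite_and]
    split_ifs <;> simp
  · refine Finset.sum_congr rfl fun b _ => Finset.sum_congr rfl fun τ _ => ?_
    simp only [balancedOn_decomposeOption_symm_some]

/-- Spitzer's lemma for zero-sum vectors: there are as many orderings with nonnegative partial sums
as there are permutations with zero-sum cycles. -/
theorem numNonneg_eq_numBalanced : ∀ (n : ℕ) (y : Fin n → ℝ), ∑ i, y i = 0 →
    numNonneg n y = numBalanced y := by
  intro n
  induction n with
  | zero =>
    intro y _
    unfold numNonneg numBalanced
    refine Finset.sum_congr rfl fun τ _ => ?_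
    rw [if_pos, if_pos]
    · intro g _; simp
    · intro j; simp
  | succ n ih =>
    intro y hy
    -- The recursion for orderings needs a nonnegative entry; a zero-sum vector has one, and it is
    -- moved to `none`. Merging it keeps the sum zero.
    obtain ⟨a, ha⟩ : ∃ a, 0 ≤ y a := by
      by_contra hcon
      push Not at hcon
      have := Finset.sum_neg (s := Finset.univ) (fun i _ => hcon i) Finset.univ_nonempty
      linarith
    set e := (finSuccEquiv' a).symm with he
    have hnone : (y ∘ e) none = y a := by simp [he]
    have hsum : ∑ i, (y ∘ e) i = 0 := by rw [← hy]; exact Equiv.sum_comp e y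
    rw [← numNonneg_comp_equiv e, ← numBalanced_comp_equiv e,
      numNonneg_option _ (by rw [hnone]; exact ha) hsum, numBalanced_option]
    have hs : (y ∘ e) none + ∑ i, (y ∘ e) (some i) = 0 := by rw [← hsum, Fintype.sum_option]
    congr 1
    · split_ifs with h0
      · refine ih _ ?_
        rw [h0, zero_add] at hs
        exact hs
      · rfl
    · refine Finset.sum_congr rfl fun b _ => ih _ ?_
      simp only [Pi.add_apply, Finset.sum_add_distrib, Finset.sum_pi_single', Finset.mem_univ,
        if_true]
      rw [← hs, add_comm]
      rfl

/-! ### Polytopes of direct sums of uniform matroids -/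

section Blocks

variable {J : Type*} [Fintype J] [DecidableEq J] {M : Matroid (Fin m)} {β : Fin m → J} {d : J → ℕ}

theorem sum_fiber_eq (β : Fin m → J) (x : Fin m → ℝ) :
    ∑ j, ∑ i ∈ Finset.univ.filter (fun i => β i = j), x i = ∑ i, x i :=
  Finset.sum_fiberwise _ _ _

theorem isMatroidOfRank_of_blocks (hE : M.E = Set.univ)
    (hM : ∀ B : Finset (Fin m), M.IsBase B ↔ ∀ j, (B.filter fun i => β i = j).card = d j) :
    IsMatroidOfRank (∑ j, d j) M := by
  classical
  refine ⟨hE, ?_⟩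
  obtain ⟨B, hB⟩ := M.exists_isBase
  have hB' : M.IsBase (B.toFinset : Finset (Fin m)) := by simpa using hB
  rw [← hB'.encard_eq_eRank, Set.encard_coe_eq_coe_finsetCard,
    Finset.card_eq_sum_card_fiberwise (f := β) (t := Finset.univ) (by simp)]
  simp only [(hM _).1 hB']

/-- The polytope of a matroid whose bases are prescribed by the number of elements in each block of
a partition. -/
theorem mem_matroidPolytope_of_blocks (hE : M.E = Set.univ)
    (hM : ∀ B : Finset (Fin m), M.IsBase B ↔ ∀ j, (B.filter fun i => β i = j).card = d j)
    {x : Fin m → ℝ} : x ∈ matroidPolytope M ↔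
      (∀ i, 0 ≤ x i ∧ x i ≤ 1) ∧
        ∀ j, ∑ i ∈ Finset.univ.filter (fun i => β i = j), x i = d j := by
  classical
  have hrank := isMatroidOfRank_of_blocks hE hM
  constructor
  · intro hx
    refine ⟨fun i => mem_Icc_of_mem_matroidPolytope hx i, fun j => le_antisymm ?_ ?_⟩
    · refine sum_subset_le_of_mem_matroidPolytope hx _ fun B hB => ?_
      rw [Finset.inter_filter, Finset.inter_univ, (hM B).1 hB]
    · refine le_sum_subset_of_mem_matroidPolytope hx _ fun B hB => ?_
      rw [Finset.inter_filter, Finset.inter_univ, (hM B).1 hB]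
  · rintro ⟨h01, hx⟩
    refine mem_matroidPolytope_of_forall_exists_base hrank ?_ fun F => ?_
    · rw [← sum_fiber_eq β x, Finset.sum_congr rfl fun j _ => hx j]
      push_cast; rfl
    · have hsub : ∀ G : Finset (Fin m), ∑ i ∈ G, x i ≤ G.card := fun G => by
        simpa using Finset.sum_le_card_nsmul G x 1 fun i _ => (h01 i).2
      obtain ⟨B₀, hB₀⟩ := M.exists_isBase
      have hB₀' : M.IsBase (B₀.toFinset : Finset (Fin m)) := by simpa using hB₀
      have hd : ∀ j, d j ≤ (Finset.univ.filter fun i => β i = j).card := fun j => by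
        rw [← (hM _).1 hB₀' j]
        exact Finset.card_le_card (Finset.filter_subset_filter _ (Finset.subset_univ _))
      -- Blockwise: if F has at most d j elements in the block, T contains them all and x ≤ 1 gives
      -- the bound; otherwise T is taken inside F, and x ≥ 0 with block sum d j gives it.
      have hT : ∀ j, ∃ T ⊆ Finset.univ.filter (fun i => β i = j), T.card = d j ∧
          ∑ i ∈ F.filter (fun i => β i = j), x i ≤ (T ∩ F).card := by
        intro j
        rcases le_total (F.filter fun i => β i = j).card (d j) with h | h
        · obtain ⟨T, hT1, hT2, hT3⟩ := Finset.exists_subsuperset_card_eq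
            (Finset.filter_subset_filter (fun i => β i = j) (Finset.subset_univ F)) h (hd j)
          refine ⟨T, hT2, hT3, (hsub _).trans ?_⟩
          exact_mod_cast Finset.card_le_card
            (Finset.subset_inter hT1 (Finset.filter_subset _ _))
        · obtain ⟨T, hT1, hT3⟩ := Finset.exists_subset_card_eq h
          refine ⟨T, hT1.trans (Finset.filter_subset_filter _ (Finset.subset_univ F)), hT3, ?_⟩
          rw [Finset.inter_eq_left.2 (hT1.trans (Finset.filter_subset _ _)), hT3, ← hx j]
          exact Finset.sum_le_sum_of_subset_of_nonneg
            (Finset.filter_subset_filter _ (Finset.subset_univ _)) fun i _ _ => (h01 i).1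
      choose T hT1 hT2 hT3 using hT
      have hfib : ∀ j, (Finset.univ.filter fun i => i ∈ T (β i)).filter (fun i => β i = j) =
          T j := by
        intro j
        ext i
        simp only [Finset.mem_filter, Finset.mem_univ, true_and]
        constructor
        · rintro ⟨h, rfl⟩; exact h
        · intro h
          have hj : β i = j := by simpa using hT1 j h
          exact ⟨hj ▸ h, hj⟩
      refine ⟨Finset.univ.filter fun i => i ∈ T (β i), (hM _).2 fun j => by
        rw [hfib, hT2], ?_⟩
      rw [← Finset.sum_fiberwise F β x,
        Finset.card_eq_sum_card_fiberwise (f := β) (t := Finset.univ) (by simp), Nat.cast_sum]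
      refine Finset.sum_le_sum fun j _ => ?_
      rw [← Finset.filter_inter, hfib]
      exact hT3 j

end Blocks

theorem isBase_uniformMatroid {k N : ℕ} {h : k ≤ N} {B : Set (Fin N)} :
    (uniformMatroid k N h).IsBase B ↔ ∃ T : Finset (Fin N), (T : Set (Fin N)) = B ∧ T.card = k :=
  Iff.rfl

instance instDecidableEqToType {α : Type*} [DecidableEq α] (s : Multiset α) :
    DecidableEq s.ToType :=
  inferInstanceAs (DecidableEq (Σ x, Fin (s.count x)))

/-- The summand of `U_λ` that contains an element. -/
noncomputable def block (p : n.Partition) (a : Fin (2 * n)) : p.parts.ToType :=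
  ((Fintype.equivFinOfCardEq (card_blocks p)).symm a).1

theorem card_filter_block_eq (p : n.Partition) (j : p.parts.ToType) (B : Finset (Fin (2 * n))) :
    (B.filter fun a => block p a = j).card = (Finset.univ.filter fun t : Fin (2 * j.1) =>
      Fintype.equivFinOfCardEq (card_blocks p) ⟨j, t⟩ ∈ B).card := by
  symm
  refine Finset.card_bij (fun t _ => Fintype.equivFinOfCardEq (card_blocks p) ⟨j, t⟩) ?_ ?_ ?_
  · intro t ht
    simp only [Finset.mem_filter, Finset.mem_univ, true_and] at ht
    refine Finset.mem_filter.2 ⟨ht, ?_⟩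
    simp only [block, Equiv.symm_apply_apply]
  · intro t _ t' _ h
    simpa using h
  · intro a ha
    simp only [Finset.mem_filter] at ha
    obtain ⟨ha, rfl⟩ := ha
    refine ⟨((Fintype.equivFinOfCardEq (card_blocks p)).symm a).2, ?_, ?_⟩
    · refine Finset.mem_filter.2 ⟨Finset.mem_univ _, ?_⟩
      exact ((Fintype.equivFinOfCardEq (card_blocks p)).apply_symm_apply a).symm ▸ ha
    · exact (Fintype.equivFinOfCardEq (card_blocks p)).apply_symm_apply a

theorem card_block_fiber (p : n.Partition) (j : p.parts.ToType) :
    (Finset.univ.filter fun a => block p a = j).card = 2 * j.1 := by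
  rw [card_filter_block_eq]
  simp

theorem sum_toType_parts (p : n.Partition) : ∑ j : p.parts.ToType, j.1 = n := by
  rw [Finset.sum_eq_multiset_sum]
  conv_rhs => rw [← p.parts_sum]
  congr 1
  exact (Multiset.map_univ p.parts id).trans (Multiset.map_id _)

theorem isBase_uniformSum (p : n.Partition) (B : Finset (Fin (2 * n))) :
    (uniformSum p).IsBase B ↔ ∀ j, (B.filter fun a => block p a = j).card = j.1 := by
  simp only [uniformSum, Matroid.mapEquiv_isBase_iff, Matroid.sigma_isBase_iff,
    isBase_uniformMatroid, card_filter_block_eq]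
  refine forall_congr' fun j => ?_
  have hset : ((Finset.univ.filter fun t : Fin (2 * j.1) =>
      Fintype.equivFinOfCardEq (card_blocks p) ⟨j, t⟩ ∈ B : Finset _) : Set (Fin (2 * j.1))) =
      Sigma.mk j ⁻¹' ((Fintype.equivFinOfCardEq (card_blocks p)).symm '' (B : Set _)) := by
    ext t
    simp [Equiv.image_symm_eq_preimage]
  constructor
  · rintro ⟨T, hT, hc⟩
    rw [← hset] at hT
    rw [← Finset.coe_injective hT, hc]
  · intro h
    exact ⟨_, hset, h⟩

theorem uniformSum_ground (p : n.Partition) : (uniformSum p).E = Set.univ := by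
  have h : ∀ j : p.parts.ToType,
    (uniformMatroid j.1 (2 * j.1) (Nat.le_mul_of_pos_left _ two_pos)).E = Set.univ := fun _ => rfl
  simp only [uniformSum, Matroid.mapEquiv_ground_eq, Matroid.sigma_ground_eq, h]
  rw [Set.eq_univ_iff_forall]
  exact fun a => ⟨(Fintype.equivFinOfCardEq (card_blocks p)).symm a, by simp, by simp⟩

theorem isMatroidOfRank_uniformSum (p : n.Partition) : IsMatroidOfRank n (uniformSum p) := by
  have := isMatroidOfRank_of_blocks (uniformSum_ground p) (isBase_uniformSum p)
  rwa [sum_toType_parts] at this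

theorem mem_matroidPolytope_uniformSum (p : n.Partition) {x : Fin (2 * n) → ℝ} :
    x ∈ matroidPolytope (uniformSum p) ↔ (∀ i, 0 ≤ x i ∧ x i ≤ 1) ∧
      ∀ j : p.parts.ToType, ∑ i ∈ Finset.univ.filter (fun i => block p i = j), x i = (j.1 : ℕ) :=
  mem_matroidPolytope_of_blocks (uniformSum_ground p) (isBase_uniformSum p)

/-- Two maps whose fibers have equal cardinalities differ by a bijection of the source. -/
theorem exists_equiv_comp_eq {α α' γ : Type*} [Fintype α] [Fintype α'] [DecidableEq γ]
    (f : α → γ) (g : α' → γ)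
    (h : ∀ c, (Finset.univ.filter fun a => f a = c).card =
      (Finset.univ.filter fun a => g a = c).card) : ∃ e : α ≃ α', g ∘ e = f := by
  have he : ∀ c, Nonempty ({a // f a = c} ≃ {a // g a = c}) := by
    intro c
    rw [← Fintype.card_eq, Fintype.card_subtype, Fintype.card_subtype, h]
  refine ⟨(Equiv.sigmaFiberEquiv f).symm.trans ((Equiv.sigmaCongrRight fun c => (he c).some).trans
    (Equiv.sigmaFiberEquiv g)), ?_⟩
  funext a
  exact ((he (f a)).some ⟨a, rfl⟩).2

/-! ### Cycle partitions -/

/-- The partition of `n` given by the cycle lengths of a permutation. -/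
def cyclePartition (τ : Equiv.Perm (Fin n)) : n.Partition where
  parts := τ.partition.parts
  parts_pos := τ.partition.parts_pos
  parts_sum := by rw [τ.partition.parts_sum, Fintype.card_fin]

/-- The cycle of an element, or the element itself if it is fixed. -/
def cycleIndex (τ : Equiv.Perm (Fin n)) (i : Fin n) :
    {c // c ∈ τ.cycleFactorsFinset} ⊕ {i // τ i = i} :=
  if h : τ i = i then Sum.inr ⟨i, h⟩ else Sum.inl ⟨τ.cycleOf i, by
    rw [Equiv.Perm.cycleOf_mem_cycleFactorsFinset_iff]
    exact Equiv.Perm.mem_support.2 h⟩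

theorem cycleIndex_apply (τ : Equiv.Perm (Fin n)) (i : Fin n) :
    cycleIndex τ (τ i) = cycleIndex τ i := by
  unfold cycleIndex
  by_cases h : τ i = i
  · simp [h]
  · have h' : ¬ τ (τ i) = τ i := fun h' => h (τ.injective h')
    rw [dif_neg h, dif_neg h']
    simp [Equiv.Perm.cycleOf_self_apply]

theorem sameCycle_of_cycleIndex_eq {τ : Equiv.Perm (Fin n)} {i j : Fin n}
    (h : cycleIndex τ i = cycleIndex τ j) : τ.SameCycle i j := by
  unfold cycleIndex at h
  split_ifs at h with hi hj hj
  · simp only [Sum.inr.injEq, Subtype.mk.injEq] at h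
    rw [h]
  · simp only [Sum.inl.injEq, Subtype.mk.injEq] at h
    exact (Equiv.Perm.sameCycle_iff_cycleOf_eq_of_mem_support (Equiv.Perm.mem_support.2 hi)
      (Equiv.Perm.mem_support.2 hj)).2 h

theorem card_cycleIndex_fiber (τ : Equiv.Perm (Fin n))
    (q : {c // c ∈ τ.cycleFactorsFinset} ⊕ {i // τ i = i}) :
    (Finset.univ.filter fun i => cycleIndex τ i = q).card =
      q.elim (fun c => c.1.support.card) (fun _ => 1) := by
  rcases q with ⟨c, hc⟩ | ⟨a, ha⟩
  · simp only [Sum.elim_inl]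
    congr 1
    ext i
    simp only [Finset.mem_filter, Finset.mem_univ, true_and]
    unfold cycleIndex
    have hcyc := Equiv.Perm.mem_cycleFactorsFinset_iff.1 hc
    constructor
    · intro h
      split_ifs at h with hi
      simp only [Sum.inl.injEq, Subtype.mk.injEq] at h
      rw [← h, Equiv.Perm.mem_support_cycleOf_iff]
      exact ⟨Equiv.Perm.SameCycle.refl _ _, Equiv.Perm.mem_support.2 hi⟩
    · intro h
      have hi : ¬ τ i = i := by
        rw [← hcyc.2 i h]
        exact Equiv.Perm.mem_support.1 h
      rw [dif_neg hi]
      simp only [Sum.inl.injEq, Subtype.mk.injEq]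
      exact (Equiv.Perm.cycle_is_cycleOf h hc).symm
  · simp only [Sum.elim_inr, Finset.card_eq_one]
    refine ⟨a, ?_⟩
    ext i
    simp only [Finset.mem_filter, Finset.mem_univ, true_and, Finset.mem_singleton]
    unfold cycleIndex
    constructor
    · intro h
      split_ifs at h with hi
      simpa using h
    · rintro rfl
      rw [dif_pos ha]

theorem map_card_cycleIndex (τ : Equiv.Perm (Fin n)) :
    (Finset.univ : Finset ({c // c ∈ τ.cycleFactorsFinset} ⊕ {i // τ i = i})).val.map
      (fun q => q.elim (fun c => c.1.support.card) (fun _ => 1)) = (cyclePartition τ).parts := by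
  have h1 : (cyclePartition τ).parts = τ.cycleType +
      Multiset.replicate (Fintype.card (Fin n) - τ.support.card) 1 := τ.parts_partition
  rw [h1, ← Finset.univ_disjSum_univ, Finset.val_disjSum, Multiset.disjSum, Multiset.map_add,
    Multiset.map_map, Multiset.map_map]
  congr 1
  · rw [Equiv.Perm.cycleType_def]
    simp only [Function.comp_def, Sum.elim_inl]
    rw [← Finset.attach_eq_univ]
    exact Multiset.attach_map_val' τ.cycleFactorsFinset.val (fun c : Equiv.Perm (Fin n) => c.support.card)
  · simp only [Function.comp_def, Sum.elim_inr, Multiset.map_const']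
    congr 1
    rw [← Finset.card_def, Finset.card_univ, Fintype.card_subtype]
    have h2 : τ.support = Finset.univ.filter fun i => ¬ τ i = i := by
      ext; simp
    have h3 := Finset.card_filter_add_card_filter_not (s := (Finset.univ : Finset (Fin n)))
      (fun i => τ i = i)
    rw [h2]
    rw [Finset.card_univ] at h3
    omega

/-- The cycles of a permutation, indexed by the parts of its cycle partition. -/
theorem exists_cycle_indexing (τ : Equiv.Perm (Fin n)) :
    ∃ κ : Fin n → (cyclePartition τ).parts.ToType, (∀ i, κ (τ i) = κ i) ∧
      (∀ i j, κ i = κ j → τ.SameCycle i j) ∧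
      ∀ j, (Finset.univ.filter fun i => κ i = j).card = j.1 := by
  have hcount : ∀ {I : Type} [Fintype I] (f : I → ℕ) (v : ℕ),
      (Finset.univ.filter fun q => f q = v).card = (Finset.univ.val.map f).count v := by
    intro I _ f v
    rw [Multiset.count_map, ← Finset.filter_val, Finset.card_def]
    simp only [eq_comm]
  -- Cycles (fixed points included) and parts give the same multiset of sizes, so they can be
  -- matched with sizes preserved.
  obtain ⟨e, he⟩ := exists_equiv_comp_eq
    (fun q : {c // c ∈ τ.cycleFactorsFinset} ⊕ {i // τ i = i} =>
      q.elim (fun c => c.1.support.card) (fun _ => 1))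
    (fun j : (cyclePartition τ).parts.ToType => j.1) (fun v => by
      rw [hcount, hcount, map_card_cycleIndex]
      congr 1
      exact ((Multiset.map_univ (cyclePartition τ).parts id).trans (Multiset.map_id _)).symm)
  refine ⟨e ∘ cycleIndex τ, fun i => by simp [cycleIndex_apply], fun i j h =>
    sameCycle_of_cycleIndex_eq (e.injective h), fun j => ?_⟩
  have h1 := card_cycleIndex_fiber τ (e.symm j)
  have h2 := congrFun he (e.symm j)
  simp only [Function.comp, Equiv.apply_symm_apply] at h2
  rw [← h2] at h1
  refine Eq.trans (congrArg Finset.card ?_) h1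
  ext i
  simp [Equiv.eq_symm_apply]

/-! ### Pairs of consecutive elements and the Catalan matroid -/

/-- The ground set `[2n]` as `n` pairs of consecutive elements. -/
def pairEquiv (n : ℕ) : Fin n × Fin 2 ≃ Fin (2 * n) :=
  finProdFinEquiv.trans (finCongr (mul_comm n 2))

theorem pairEquiv_val (i : Fin n) (b : Fin 2) : (pairEquiv n (i, b) : ℕ) = b + 2 * i := rfl

theorem sum_pairs {R : Type*} [AddCommMonoid R] (f : Fin (2 * n) → R) :
    ∑ a, f a = ∑ i, (f (pairEquiv n (i, 0)) + f (pairEquiv n (i, 1))) := by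
  rw [← Equiv.sum_comp (pairEquiv n), Fintype.sum_prod_type]
  simp only [Fin.sum_univ_two]

/-- The excess of the coordinate sum of each pair over `1`. -/
def excess (x : Fin (2 * n) → ℝ) (i : Fin n) : ℝ :=
  x (pairEquiv n (i, 0)) + x (pairEquiv n (i, 1)) - 1

theorem sum_excess (x : Fin (2 * n) → ℝ) : ∑ i, excess x i = ∑ a, x a - n := by
  rw [sum_pairs]
  simp [excess, Finset.sum_sub_distrib]

/-- The permutation of `[2n]` induced by a permutation of the pairs. -/
def liftPerm (σ : Equiv.Perm (Fin n)) : Equiv.Perm (Fin (2 * n)) :=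
  (pairEquiv n).symm.trans ((Equiv.prodCongr σ (Equiv.refl (Fin 2))).trans (pairEquiv n))

theorem excess_comp_liftPerm (σ : Equiv.Perm (Fin n)) (x : Fin (2 * n) → ℝ) :
    excess (x ∘ liftPerm σ) = excess x ∘ σ := by
  funext i
  simp [excess, liftPerm]

theorem card_odd (n : ℕ) :
    (Finset.univ.filter fun i : Fin (2 * n) => (i : ℕ) % 2 = 1).card = n := by
  rw [Finset.card_filter, sum_pairs]
  simp [pairEquiv_val, Nat.add_mod]

theorem isMatroidOfRank_catalanMatroid (n : ℕ) : IsMatroidOfRank n (catalanMatroid n) :=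
  isMatroidOfRank_schubertMatroid (card_odd n)

/-- Initial segments made of whole pairs give the partial sums of the excess; a segment ending
inside a pair adds only a coordinate x ≥ 0 and no new condition. -/
theorem mem_matroidPolytope_catalanMatroid {x : Fin (2 * n) → ℝ} :
    x ∈ matroidPolytope (catalanMatroid n) ↔
      (∀ i, 0 ≤ x i ∧ x i ≤ 1) ∧ ∑ i, x i = n ∧ NonnegPartialSums (excess x) := by
  unfold catalanMatroid
  rw [mem_matroidPolytope_schubertMatroid, card_odd]
  refine and_congr_right fun h01 => and_congr_right fun _ => ?_
  have hsub : ∀ j : Fin (2 * n), ∑ i ∈ Finset.univ.filter (· ≤ j), x i -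
      (((Finset.univ.filter fun i : Fin (2 * n) => (i : ℕ) % 2 = 1).filter (· ≤ j)).card : ℝ) =
      ∑ i : Fin n, ((if 2 * (i : ℕ) ≤ j then x (pairEquiv n (i, 0)) else 0) +
        (if 2 * (i : ℕ) + 1 ≤ j then x (pairEquiv n (i, 1)) - 1 else 0)) := by
    intro j
    rw [Finset.filter_filter, Finset.card_filter, Finset.sum_filter, sum_pairs, sum_pairs]
    push_cast
    rw [← Finset.sum_sub_distrib]
    refine Finset.sum_congr rfl fun i _ => ?_
    have h0 : (pairEquiv n (i, 0) ≤ j) ↔ 2 * (i : ℕ) ≤ j := by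
      rw [Fin.le_def, pairEquiv_val]; simp
    have h1 : (pairEquiv n (i, 1) ≤ j) ↔ 2 * (i : ℕ) + 1 ≤ j := by
      rw [Fin.le_def, pairEquiv_val, add_comm]; simp
    have h2 : (pairEquiv n (i, 0) : ℕ) % 2 = 0 := by rw [pairEquiv_val]; simp
    have h3 : (pairEquiv n (i, 1) : ℕ) % 2 = 1 := by rw [pairEquiv_val]; simp
    simp only [h0, h1, h2, h3]
    by_cases hj : 2 * (i : ℕ) + 1 ≤ j
    · simp [hj]; ring
    · simp [hj]
  constructor
  · intro h q
    -- The first q pairs end at index 2q - 1, counted from 0; the minimum caps q, since partial sums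
    -- are constant from n on.
    rcases Nat.eq_zero_or_pos (min q n) with hq | hq
    · refine Finset.sum_nonneg fun i _ => ?_
      have := i.2
      rw [if_neg (by omega)]
    · have hlt : 2 * min q n - 1 < 2 * n := by omega
      have h1 := sub_nonneg.2 (h ⟨2 * min q n - 1, hlt⟩)
      rw [hsub] at h1
      refine h1.trans_eq (Finset.sum_congr rfl fun i _ => ?_)
      have hi := i.2
      by_cases hiq : (i : ℕ) < q
      · rw [if_pos (by simp only; omega), if_pos (by simp only; omega), if_pos hiq]
        unfold excess; ring
      · rw [if_neg (by simp only; omega), if_neg (by simp only; omega), if_neg hiq, add_zero]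
  · intro h j
    rw [← sub_nonneg, hsub]
    -- (j + 1) / 2 is the number of pairs lying entirely in the segment up to j.
    refine (h ((j + 1) / 2)).trans (Finset.sum_le_sum fun i _ => ?_)
    by_cases hj : 2 * (i : ℕ) + 1 ≤ j
    · rw [if_pos (by omega), if_pos (by omega), if_pos hj]
      unfold excess; linarith
    · rw [if_neg (by omega), if_neg hj, add_zero]
      split_ifs
      · exact (h01 _).1
      · exact le_rfl

/-! ### Relabeled sums of uniform matroids and zero-sum cycles -/

theorem apply_eq_of_sameCycle {τ : Equiv.Perm (Fin n)} {g : Fin n → ℝ} (hg : ∀ i, g (τ i) = g i)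
    {i j : Fin n} (h : τ.SameCycle i j) : g i = g j := by
  obtain ⟨s, -, hs⟩ := h.exists_pow_eq'
  rw [← hs]
  clear hs
  induction s with
  | zero => simp
  | succ s ih => rw [pow_succ', Equiv.Perm.mul_apply, hg, ih]

/-- Indicators of the fibers of κ are invariant, and every invariant function is constant on these
fibers. -/
theorem balancedOn_iff_of_indexing {J : Type*} [Fintype J] [DecidableEq J]
    {τ : Equiv.Perm (Fin n)} (κ : Fin n → J) (h1 : ∀ i, κ (τ i) = κ i)
    (h2 : ∀ i j, κ i = κ j → τ.SameCycle i j) (y : Fin n → ℝ) :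
    BalancedOn τ y ↔ ∀ j, ∑ i ∈ Finset.univ.filter (fun i => κ i = j), y i = 0 := by
  constructor
  · intro h j
    have := h (fun i => if κ i = j then 1 else 0) (fun i => by simp only [h1])
    rw [Finset.sum_filter]
    simpa using this
  · intro h g hg
    rw [← Finset.sum_fiberwise Finset.univ κ]
    refine Finset.sum_eq_zero fun j _ => ?_
    rcases (Finset.univ.filter fun i => κ i = j).eq_empty_or_nonempty with he | ⟨i₀, hi₀⟩
    · rw [he, Finset.sum_empty]
    · have : ∀ i ∈ Finset.univ.filter (fun i => κ i = j), g i * y i = g i₀ * y i := by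
        intro i hi
        rw [Finset.mem_filter] at hi hi₀
        rw [apply_eq_of_sameCycle hg (h2 i i₀ (hi.2.trans hi₀.2.symm))]
      rw [Finset.sum_congr rfl this, ← Finset.mul_sum, h j, mul_zero]

/-- For every permutation of the pairs, a relabeling of the sum of uniform matroids of its cycle
type has the polytope cut out by the zero-sum conditions on its cycles. -/
theorem exists_relabeled_uniformSum (τ : Equiv.Perm (Fin n)) :
    ∃ e : Equiv.Perm (Fin (2 * n)), ∀ x : Fin (2 * n) → ℝ,
      x ∈ matroidPolytope ((uniformSum (cyclePartition τ)).mapEquiv e) ↔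
        (∀ i, 0 ≤ x i ∧ x i ≤ 1) ∧ BalancedOn τ (excess x) := by
  obtain ⟨κ, h1, h2, h3⟩ := exists_cycle_indexing τ
  have hpair : ∀ i b, κ ((pairEquiv n).symm (pairEquiv n (i, b))).1 = κ i := by
    intro i b; rw [Equiv.symm_apply_apply]
  -- A block of U_λ and the pairs of the matching cycle both have twice the cycle length many
  -- elements, so a relabeling carries blocks to cycles.
  obtain ⟨e, he⟩ := exists_equiv_comp_eq (block (cyclePartition τ))
    (fun a => κ ((pairEquiv n).symm a).1) (fun j => by
      rw [card_block_fiber, Finset.card_filter, sum_pairs, ← h3 j, Finset.card_filter,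
        Finset.mul_sum]
      refine Finset.sum_congr rfl fun i _ => ?_
      rw [hpair, hpair]; ring)
  refine ⟨e, fun x => ?_⟩
  rw [mem_matroidPolytope_mapEquiv, mem_matroidPolytope_uniformSum,
    balancedOn_iff_of_indexing κ h1 h2]
  have hbox : (∀ i, 0 ≤ (x ∘ e) i ∧ (x ∘ e) i ≤ 1) ↔ ∀ i, 0 ≤ x i ∧ x i ≤ 1 :=
    ⟨fun h i => by simpa using h (e.symm i), fun h i => h _⟩
  rw [hbox]
  refine and_congr_right fun _ => forall_congr' fun j => ?_
  have hsum : ∑ i ∈ Finset.univ.filter (fun i => block (cyclePartition τ) i = j), (x ∘ e) i =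
      ∑ i ∈ Finset.univ.filter (fun i => κ i = j), excess x i + (j.1 : ℕ) := by
    have hc : ((j.1 : ℕ) : ℝ) = ∑ i ∈ Finset.univ.filter (fun i => κ i = j), (1 : ℝ) := by
      rw [← h3 j]; simp
    rw [hc, ← Finset.sum_add_distrib, Finset.sum_filter, Finset.sum_filter]
    have : ∀ a, (if block (cyclePartition τ) a = j then (x ∘ e) a else 0) =
        (fun b => if κ ((pairEquiv n).symm b).1 = j then x b else 0) (e a) := by
      intro a
      rw [← congrFun he a]
      rfl
    rw [Finset.sum_congr rfl fun a _ => this a,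
      Equiv.sum_comp e (fun b => if κ ((pairEquiv n).symm b).1 = j then x b else 0), sum_pairs]
    refine Finset.sum_congr rfl fun i _ => ?_
    rw [hpair, hpair]
    split_ifs
    · unfold excess; ring
    · simp
  rw [hsum]
  exact ⟨fun h => by linarith, fun h => by linarith⟩

/-- The symmetrized Catalan matroid and the sums of uniform matroids, indexed by permutations. -/
theorem factorial_smul_coordVec_catalanMatroid (n : ℕ) :
    (n.factorial : ℝ) • coordVec n (catalanMatroid n) =
      ∑ τ : Equiv.Perm (Fin n), coordVec n (uniformSum (cyclePartition τ)) := by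
  classical
  choose e he using exists_relabeled_uniformSum (n := n)
  have h := sum_coordVec_eq (k := n) Finset.univ Finset.univ
    (fun σ : Equiv.Perm (Fin n) => (catalanMatroid n).mapEquiv (liftPerm σ))
    (fun τ : Equiv.Perm (Fin n) => (uniformSum (cyclePartition τ)).mapEquiv (e τ))
    (fun σ => (isMatroidOfRank_catalanMatroid n).mapEquiv _)
    (fun τ => (isMatroidOfRank_uniformSum _).mapEquiv _) (fun x => by
      by_cases hx : (∀ i, 0 ≤ x i ∧ x i ≤ 1) ∧ ∑ i, x i = n
      · have hsp := numNonneg_eq_numBalanced n (excess x) (by rw [sum_excess, hx.2, sub_self])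
        unfold numNonneg numBalanced at hsp
        have hsp' := congrArg (Nat.cast : ℕ → ℤ) hsp
        push_cast at hsp'
        have h1 : ∀ σ : Equiv.Perm (Fin n), (matroidPolytope
            ((catalanMatroid n).mapEquiv (liftPerm σ))).indicator (fun _ => (1 : ℤ)) x =
            if NonnegPartialSums (excess x ∘ σ) then 1 else 0 := by
          intro σ
          rw [indicator_matroidPolytope_mapEquiv, Set.indicator_apply]
          refine if_congr ?_ rfl rfl
          rw [mem_matroidPolytope_catalanMatroid, excess_comp_liftPerm]
          have hs : ∑ i, (x ∘ liftPerm σ) i = n := by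
            rw [← hx.2]; exact Equiv.sum_comp (liftPerm σ) x
          exact ⟨fun h => h.2.2, fun h => ⟨fun i => hx.1 _, hs, h⟩⟩
        have h2 : ∀ τ : Equiv.Perm (Fin n), (matroidPolytope
            ((uniformSum (cyclePartition τ)).mapEquiv (e τ))).indicator (fun _ => (1 : ℤ)) x =
            if BalancedOn τ (excess x) then 1 else 0 := by
          intro τ
          rw [Set.indicator_apply]
          refine if_congr ?_ rfl rfl
          rw [he]
          exact ⟨fun h => h.2, fun h => ⟨hx.1, h⟩⟩
        rw [Finset.sum_congr rfl fun σ _ => h1 σ, Finset.sum_congr rfl fun τ _ => h2 τ]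
        exact hsp'
      -- Outside the cube slice with coordinate sum n all indicators vanish, and Spitzer's lemma is
      -- not needed.
      · have h0 : ∀ M : Matroid (Fin (2 * n)), IsMatroidOfRank n M →
            (matroidPolytope M).indicator (fun _ => (1 : ℤ)) x = 0 := fun M hM =>
          Set.indicator_of_notMem (fun hxM => hx ⟨mem_Icc_of_mem_matroidPolytope hxM,
            sum_eq_of_mem_matroidPolytope hM hxM⟩) _
        rw [Finset.sum_eq_zero fun σ _ => h0 _ ((isMatroidOfRank_catalanMatroid n).mapEquiv _),
          Finset.sum_eq_zero fun τ _ => h0 _ ((isMatroidOfRank_uniformSum _).mapEquiv _)])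
  simp only [coordVec_mapEquiv (isMatroidOfRank_catalanMatroid n),
    coordVec_mapEquiv (isMatroidOfRank_uniformSum _)] at h
  rw [← h, Finset.sum_const, Finset.card_univ, Fintype.card_perm, Fintype.card_fin,
    Nat.cast_smul_eq_nsmul]

/-! ### Counting permutations by cycle partition -/

theorem parts_eq_filter_add_replicate (p : n.Partition) :
    p.parts = p.parts.filter (2 ≤ ·) + Multiset.replicate (p.parts.count 1) 1 := by
  conv_lhs => rw [← Multiset.filter_add_not (2 ≤ ·) p.parts]
  congr 1
  rw [← Multiset.filter_eq']
  refine Multiset.filter_congr fun i hi => ?_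
  have := p.parts_pos hi
  omega

/-- The cycle type omits fixed points, but their number is recovered from the total n. -/
theorem cyclePartition_eq_iff (τ : Equiv.Perm (Fin n)) (p : n.Partition) :
    cyclePartition τ = p ↔ τ.cycleType = p.parts.filter (2 ≤ ·) := by
  constructor
  · rintro rfl
    exact Equiv.Perm.filter_parts_partition_eq_cycleType.symm
  · intro h
    refine Nat.Partition.ext ?_
    have h1 : (cyclePartition τ).parts = τ.cycleType +
      Multiset.replicate (Fintype.card (Fin n) - τ.support.card) 1 := τ.parts_partition
    have h2 := p.parts_sum
    rw [parts_eq_filter_add_replicate p, Multiset.sum_add, Multiset.sum_replicate] at h2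
    rw [h1, parts_eq_filter_add_replicate p, ← Equiv.Perm.sum_cycleType, h, Fintype.card_fin]
    congr 2
    simp only [smul_eq_mul, mul_one] at h2
    omega

theorem zPart_eq (hn : 1 ≤ n) (p : n.Partition) :
    zPart p = (n - (p.parts.filter (2 ≤ ·)).sum).factorial * (p.parts.filter (2 ≤ ·)).prod *
      ∏ i ∈ (p.parts.filter (2 ≤ ·)).toFinset,
        ((p.parts.filter (2 ≤ ·)).count i).factorial := by
  have hIcc : ∀ i ∈ p.parts, i ∈ Finset.Icc 1 n := fun i hi =>
    Finset.mem_Icc.2 ⟨p.parts_pos hi, Nat.Partition.le_of_mem_parts hi⟩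
  have h1 : n - (p.parts.filter (2 ≤ ·)).sum = p.parts.count 1 := by
    have h2 := p.parts_sum
    rw [parts_eq_filter_add_replicate p, Multiset.sum_add, Multiset.sum_replicate] at h2
    simp only [smul_eq_mul, mul_one] at h2
    omega
  have h2 : (p.parts.filter (2 ≤ ·)).prod = ∏ i ∈ Finset.Icc 1 n, i ^ p.parts.count i := by
    have : p.parts.prod = (p.parts.filter (2 ≤ ·)).prod := by
      conv_lhs => rw [parts_eq_filter_add_replicate p]
      simp
    rw [← this, Finset.prod_multiset_count]
    refine Finset.prod_subset (fun i hi => hIcc i (Multiset.mem_toFinset.1 hi)) fun i _ hi => ?_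
    rw [Multiset.mem_toFinset] at hi
    rw [Multiset.count_eq_zero_of_notMem hi, pow_zero]
  have h3 : ∏ i ∈ Finset.Icc 1 n, (p.parts.count i).factorial = (p.parts.count 1).factorial *
      ∏ i ∈ (p.parts.filter (2 ≤ ·)).toFinset,
        ((p.parts.filter (2 ≤ ·)).count i).factorial := by
    rw [← Finset.mul_prod_erase _ _ (Finset.mem_Icc.2 ⟨le_rfl, hn⟩)]
    congr 1
    symm
    have hcount : ∀ i, 2 ≤ i → (p.parts.filter (2 ≤ ·)).count i = p.parts.count i := fun i hi =>
      Multiset.count_filter_of_pos hi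
    rw [Finset.prod_congr rfl fun i hi => congrArg Nat.factorial
      (hcount i (Multiset.mem_filter.1 (Multiset.mem_toFinset.1 hi)).2)]
    refine Finset.prod_subset (fun i hi => ?_) fun i hi hi' => ?_
    · rw [Multiset.mem_toFinset, Multiset.mem_filter] at hi
      exact Finset.mem_erase.2 ⟨by omega, hIcc i hi.1⟩
    · rw [Finset.mem_erase, Finset.mem_Icc] at hi
      rw [← hcount i (by omega), Multiset.count_eq_zero_of_notMem
        (fun h => hi' (Multiset.mem_toFinset.2 h)), Nat.factorial_zero]
  unfold zPart
  rw [Finset.prod_mul_distrib, h1, h2, h3]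
  ring

/-- The size of a conjugacy class times the order z_λ of a centralizer. -/
theorem card_cyclePartition_mul_zPart (hn : 1 ≤ n) (p : n.Partition) :
    (Finset.univ.filter fun τ : Equiv.Perm (Fin n) => cyclePartition τ = p).card * zPart p =
      n.factorial := by
  have h := Equiv.Perm.card_of_cycleType_mul_eq (Fin n) (p.parts.filter (2 ≤ ·))
  rw [Fintype.card_fin, ← zPart_eq hn, if_pos] at h
  · rw [← h]
    congr 2
    ext τ
    simp [cyclePartition_eq_iff]
  · refine ⟨?_, fun a ha => (Multiset.mem_filter.1 ha).2⟩
    have h2 := p.parts_sum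
    rw [parts_eq_filter_add_replicate p, Multiset.sum_add] at h2
    omega

theorem zPart_pos (p : n.Partition) : 0 < zPart p := by
  refine Finset.prod_pos fun i hi => ?_
  have := (Finset.mem_Icc.1 hi).1
  positivity

theorem card_cyclePartition_div (hn : 1 ≤ n) (p : n.Partition) :
    ((Finset.univ.filter fun τ : Equiv.Perm (Fin n) => cyclePartition τ = p).card : ℝ) /
      n.factorial = 1 / zPart p := by
  have h1 : (zPart p : ℝ) ≠ 0 := by exact_mod_cast (zPart_pos p).ne'
  have h2 : (n.factorial : ℝ) ≠ 0 := by exact_mod_cast n.factorial_ne_zero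
  rw [div_eq_div_iff h2 h1, one_mul]
  exact_mod_cast card_cyclePartition_mul_zPart hn p

theorem sum_one_div_zPart (hn : 1 ≤ n) : ∑ p : n.Partition, (1 : ℝ) / zPart p = 1 := by
  have h2 : (n.factorial : ℝ) ≠ 0 := by exact_mod_cast n.factorial_ne_zero
  rw [Finset.sum_congr rfl fun p _ => (card_cyclePartition_div hn p).symm, ← Finset.sum_div,
    div_eq_one_iff_eq h2, ← Nat.cast_sum]
  congr 1
  rw [← Finset.card_eq_sum_card_fiberwise (f := cyclePartition) (t := Finset.univ) (by simp),
    Finset.card_univ, Fintype.card_perm, Fintype.card_fin]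

theorem coordVec_catalanMatroid (hn : 1 ≤ n) : coordVec n (catalanMatroid n) =
    ∑ p : n.Partition, ((1 : ℝ) / zPart p) • coordVec n (uniformSum p) := by
  have h2 : (n.factorial : ℝ) ≠ 0 := by exact_mod_cast n.factorial_ne_zero
  have h := factorial_smul_coordVec_catalanMatroid n
  rw [← Finset.sum_fiberwise Finset.univ cyclePartition] at h
  have h3 : ∀ p : n.Partition,
      ∑ τ ∈ Finset.univ.filter (fun τ : Equiv.Perm (Fin n) => cyclePartition τ = p),
        coordVec n (uniformSum (cyclePartition τ)) =
      ((Finset.univ.filter fun τ : Equiv.Perm (Fin n) => cyclePartition τ = p).card : ℝ) •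
        coordVec n (uniformSum p) := by
    intro p
    rw [Nat.cast_smul_eq_nsmul, ← Finset.sum_const]
    exact Finset.sum_congr rfl fun τ hτ => by rw [(Finset.mem_filter.1 hτ).2]
  rw [Finset.sum_congr rfl fun p _ => h3 p] at h
  rw [← inv_smul_smul₀ h2 (coordVec n (catalanMatroid n)), h, Finset.smul_sum]
  refine Finset.sum_congr rfl fun p _ => ?_
  rw [smul_smul, ← card_cyclePartition_div hn, div_eq_inv_mul]

/-! ### Positive convex combinations -/

theorem exists_weights_of_mem_convexHull_range {ι E : Type*} [Fintype ι] [AddCommGroup E]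
    [Module ℝ E] (v : ι → E) {q : E} (hq : q ∈ convexHull ℝ (Set.range v)) :
    ∃ u : ι → ℝ, (∀ i, 0 ≤ u i) ∧ ∑ i, u i = 1 ∧ ∑ i, u i • v i = q := by
  classical
  have hc : Convex ℝ {q : E | ∃ u : ι → ℝ, (∀ i, 0 ≤ u i) ∧ ∑ i, u i = 1 ∧
      ∑ i, u i • v i = q} := by
    rintro _ ⟨u, hu, hu1, rfl⟩ _ ⟨w, hw, hw1, rfl⟩ a b ha hb hab
    refine ⟨fun i => a * u i + b * w i, fun i => ?_, ?_, ?_⟩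
    · have := hu i
      have := hw i
      positivity
    · rw [Finset.sum_add_distrib, ← Finset.mul_sum, ← Finset.mul_sum, hu1, hw1, mul_one, mul_one,
        hab]
    · simp only [add_smul, mul_smul, Finset.sum_add_distrib, Finset.smul_sum]
  refine convexHull_min ?_ hc hq
  rintro _ ⟨i, rfl⟩
  refine ⟨Pi.single i 1, fun j => ?_, by simp, by simp [Pi.single_apply, ite_smul]⟩
  rw [Pi.single_apply]
  split_ifs <;> norm_num

/-- A convex combination with positive weights lies in the relative interior. -/
theorem sum_smul_mem_intrinsicInterior {ι E : Type*} [Fintype ι] [NormedAddCommGroup E]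
    [NormedSpace ℝ E] [FiniteDimensional ℝ E] (v : ι → E) (w : ι → ℝ) (hw : ∀ i, 0 < w i)
    (hw1 : ∑ i, w i = 1) :
    ∑ i, w i • v i ∈ intrinsicInterior ℝ (convexHull ℝ (Set.range v)) := by
  have hne : Nonempty ι := by
    by_contra h
    rw [not_nonempty_iff] at h
    simp at hw1
  set K := convexHull ℝ (Set.range v) with hK
  have hKc : Convex ℝ K := convex_convexHull _ _
  have hKv : ∀ u : ι → ℝ, (∀ i, 0 ≤ u i) → ∑ i, u i = 1 → ∑ i, u i • v i ∈ K := fun u hu hu1 =>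
    hKc.sum_mem (fun i _ => hu i) hu1 fun i _ => subset_convexHull _ _ ⟨i, rfl⟩
  obtain ⟨q, hq⟩ := Set.Nonempty.intrinsicInterior hKc
    (Set.Nonempty.convexHull (Set.range_nonempty v))
  obtain ⟨u, hu, hu1, huq⟩ :=
    exists_weights_of_mem_convexHull_range v (intrinsicInterior_subset hq)
  obtain ⟨i₀, -, hi₀⟩ := Finset.exists_min_image Finset.univ w Finset.univ_nonempty
  -- Since u ≤ 1, subtracting ε u leaves the weights nonnegative; halving keeps ε < 1. The target
  -- point is thus the image of the relative interior point q under the homothety of ratio ε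
  -- centered at a point z of the hull.
  set ε := w i₀ / 2 with hε
  have hε0 : 0 < ε := half_pos (hw i₀)
  have hwle : ∀ i, w i ≤ 1 := fun i => hw1 ▸
    Finset.single_le_sum (fun i _ => (hw i).le) (Finset.mem_univ i)
  have hule : ∀ i, u i ≤ 1 := fun i => hu1 ▸
    Finset.single_le_sum (fun i _ => hu i) (Finset.mem_univ i)
  have hε1 : 0 < 1 - ε := by have := hwle i₀; linarith
  set z := ∑ i, ((w i - ε * u i) / (1 - ε)) • v i with hz
  have hzK : z ∈ K := by
    refine hKv _ (fun i => div_nonneg ?_ hε1.le) ?_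
    · have h1 := hi₀ i (Finset.mem_univ i)
      have h2 := hw i₀
      have h3 := hule i
      nlinarith
    · rw [← Finset.sum_div, Finset.sum_sub_distrib, ← Finset.mul_sum, hw1, hu1, mul_one,
        div_self hε1.ne']
  have hcomb : ∑ i, w i • v i = ε • (q - z) + z := by
    have h1 : (1 - ε) • z = ∑ i, w i • v i - ε • q := by
      rw [hz, Finset.smul_sum, ← huq, Finset.smul_sum, ← Finset.sum_sub_distrib]
      refine Finset.sum_congr rfl fun i _ => ?_
      rw [smul_smul, mul_div_cancel₀ _ hε1.ne', sub_smul, mul_smul]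
    have h2 : ∑ i, w i • v i = (1 - ε) • z + ε • q := by rw [h1]; abel
    rw [h2, sub_smul, one_smul, smul_sub]
    abel
  rw [mem_intrinsicInterior] at hq ⊢
  obtain ⟨q', hq', rfl⟩ := hq
  set z' : affineSpan ℝ K := ⟨z, subset_affineSpan _ _ hzK⟩ with hz'
  have : Nonempty (affineSpan ℝ K) := ⟨z'⟩
  set φ := AffineMap.homothety z' ε with hφ
  have hcoe : ∀ y : affineSpan ℝ K, ((φ y : affineSpan ℝ K) : E) = ε • ((y : E) - z) + z := by
    intro y
    simp [hφ, AffineMap.homothety_apply, hz']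
  -- The homothety is open in the affine span and, by convexity, maps the hull into itself, so it
  -- carries interior points to interior points.
  have hopen : IsOpen (φ '' interior ((↑) ⁻¹' K : Set (affineSpan ℝ K))) :=
    AffineMap.homothety_isOpenMap z' ε hε0.ne' _ isOpen_interior
  have hsub : φ '' interior ((↑) ⁻¹' K : Set (affineSpan ℝ K)) ⊆ (↑) ⁻¹' K := by
    rintro _ ⟨y, hy, rfl⟩
    have hyK : y ∈ ((↑) ⁻¹' K : Set (affineSpan ℝ K)) := interior_subset hy
    rw [Set.mem_preimage] at hyK
    rw [Set.mem_preimage, hcoe]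
    have := hKc hyK hzK hε0.le hε1.le (by ring)
    convert this using 1
    rw [smul_sub, sub_smul, one_smul]
    abel
  refine ⟨φ q', interior_maximal hsub hopen ⟨q', hq', rfl⟩, ?_⟩
  rw [hcoe, hcomb]

/-- Lumping all terms but the i-th into their center of mass puts the extreme point in an open
segment starting at v i. -/
theorem eq_of_mem_extremePoints_of_sum {ι E : Type*} [Fintype ι] [AddCommGroup E]
    [Module ℝ E] {A : Set E} (hA : Convex ℝ A) (v : ι → E) (w : ι → ℝ) (hw : ∀ i, 0 < w i)
    (hw1 : ∑ i, w i = 1) (hv : ∀ i, v i ∈ A)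
    (hx : ∑ i, w i • v i ∈ A.extremePoints ℝ) (i : ι) : v i = ∑ i, w i • v i := by
  classical
  have hsum := Finset.add_sum_erase Finset.univ w (Finset.mem_univ i)
  have hsumv := Finset.add_sum_erase Finset.univ (fun i => w i • v i) (Finset.mem_univ i)
  rw [hw1] at hsum
  rcases (Finset.univ.erase i).eq_empty_or_nonempty with he | he
  · rw [he, Finset.sum_empty, add_zero] at hsum hsumv
    rw [← hsumv, hsum, one_smul]
  · have hpos : 0 < ∑ j ∈ Finset.univ.erase i, w j := Finset.sum_pos (fun j _ => hw j) he
    have hmem := hA.centerMass_mem (fun j _ => (hw j).le) hpos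
      (fun j (_ : j ∈ Finset.univ.erase i) => hv j)
    have hseg : ∑ i, w i • v i ∈ openSegment ℝ (v i)
        ((Finset.univ.erase i).centerMass w v) := by
      refine ⟨w i, ∑ j ∈ Finset.univ.erase i, w j, hw i, hpos, hsum, ?_⟩
      rw [Finset.centerMass, smul_smul, mul_inv_cancel₀ hpos.ne', one_smul]
      exact hsumv
    exact ((mem_extremePoints.1 hx).2 _ (hv i) _ hmem hseg).1

/-! ### The Catalan matroid is not extremal -/

theorem galeLE_last (T : Finset (Fin (2 * n))) (hT : T.card = n) :
    GaleLE T (Finset.univ.filter fun i : Fin (2 * n) => n ≤ (i : ℕ)) := by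
  have hS : (Finset.univ.filter fun i : Fin (2 * n) => n ≤ (i : ℕ)).card = n := by
    have h1 := Fin.card_filter_val_lt (n := 2 * n) (m := n)
    have h2 := Finset.card_filter_add_card_filter_not (s := (Finset.univ : Finset (Fin (2 * n))))
      (fun i => (i : ℕ) < n)
    simp only [not_lt] at h2
    rw [Finset.card_univ, Fintype.card_fin] at h2
    omega
  refine ⟨hT.trans hS.symm, fun j => ?_⟩
  set S := Finset.univ.filter fun i : Fin (2 * n) => n ≤ (i : ℕ) with hSdef
  have h1 := card_filter_le_add_card_filter_not_le T j
  have h2 := card_filter_le_add_card_filter_not_le S j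
  by_cases hj : n ≤ (j : ℕ)
  · have h3 : T.filter (¬ · ≤ j) ⊆ S.filter (¬ · ≤ j) := by
      intro i hi
      rw [Finset.mem_filter] at hi ⊢
      refine ⟨?_, hi.2⟩
      have := hi.2
      rw [Fin.le_def] at this
      simp only [hSdef, Finset.mem_filter, Finset.mem_univ, true_and]
      omega
    have := Finset.card_le_card h3
    omega
  · have h3 : S.filter (· ≤ j) = ∅ := by
      rw [Finset.filter_eq_empty_iff]
      intro i hi hij
      simp only [hSdef, Finset.mem_filter, Finset.mem_univ, true_and] at hi
      rw [Fin.le_def] at hij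
      omega
    rw [h3]
    simp

theorem isBase_uniformSum_indiscrete (hn : n ≠ 0) (B : Finset (Fin (2 * n))) :
    (uniformSum (Nat.Partition.indiscrete n)).IsBase B ↔ B.card = n := by
  refine ⟨card_eq_of_isBase (isMatroidOfRank_uniformSum _), fun hB => ?_⟩
  rw [isBase_uniformSum]
  have hmem : ∀ j : (Nat.Partition.indiscrete n).parts.ToType, j.1 = n := by
    intro j
    have h : ∀ a ∈ (Nat.Partition.indiscrete n).parts, a = n := by
      simp [Nat.Partition.indiscrete_parts hn]
    exact h _ (Multiset.coe_mem (x := j))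
  have hsub : ∀ i j : (Nat.Partition.indiscrete n).parts.ToType, i = j := by
    have hc : Fintype.card (Nat.Partition.indiscrete n).parts.ToType = 1 := by
      rw [Multiset.card_coe, Nat.Partition.indiscrete_parts hn, Multiset.card_singleton]
    have := Fintype.card_le_one_iff.1 hc.le
    exact this
  intro j
  rw [Finset.filter_true_of_mem fun a _ => hsub _ _, hB, hmem]

/-- The last n elements are the Gale-largest n-subset, so this Schubert matroid is uniform. Being
Schubert, U_{n,2n} can be compared with C_n by isomorphism class alone. -/
theorem uniformSum_indiscrete_eq (hn : n ≠ 0) : uniformSum (Nat.Partition.indiscrete n) =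
    schubertMatroid (Finset.univ.filter fun i : Fin (2 * n) => n ≤ (i : ℕ)) := by
  classical
  refine Matroid.ext_isBase (uniformSum_ground _) fun B _ => ?_
  have h1 := isBase_uniformSum_indiscrete hn B.toFinset
  have h2 := isBase_schubertMatroid (B := B.toFinset)
    (S := Finset.univ.filter fun i : Fin (2 * n) => n ≤ (i : ℕ))
  rw [Set.coe_toFinset] at h1 h2
  rw [h1, h2]
  refine ⟨galeLE_last _, fun h => ?_⟩
  rw [h.1]
  obtain ⟨T, -, hT⟩ := Finset.exists_subset_card_eq
    (s := (Finset.univ : Finset (Fin (2 * n)))) (n := n) (by simp; omega)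
  rw [← (galeLE_last T hT).1, hT]

theorem not_iso_catalanMatroid (hn : 2 ≤ n) :
    ¬ Iso (catalanMatroid n) (uniformSum (Nat.Partition.indiscrete n)) := by
  rintro ⟨σ, hσ⟩
  set S := Finset.univ.filter fun i : Fin (2 * n) => n ≤ (i : ℕ) with hS
  have hScard : S.card = n := by
    obtain ⟨T, -, hT⟩ := Finset.exists_subset_card_eq
      (s := (Finset.univ : Finset (Fin (2 * n)))) (n := n) (by simp; omega)
    rw [← (galeLE_last T hT).1, hT]
  have h1 : (uniformSum (Nat.Partition.indiscrete n)).IsBase (S.map σ.toEmbedding : Finset _) :=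
    (isBase_uniformSum_indiscrete (by omega) _).2 (by rw [Finset.card_map, hScard])
  rw [hσ, isBase_mapEquiv_image] at h1
  -- Every base of C_n meets the first pair, whereas for n ≥ 2 the last n elements avoid it; yet in
  -- the uniform matroid every n-subset is a base.
  have h2 := (isBase_schubertMatroid.1 h1).2 ⟨1, by omega⟩
  have h3 : S.filter (· ≤ (⟨1, by omega⟩ : Fin (2 * n))) = ∅ := by
    rw [Finset.filter_eq_empty_iff]
    intro i hi hij
    simp only [hS, Finset.mem_filter, Finset.mem_univ, true_and] at hi
    rw [Fin.le_def] at hij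
    simp only at hij
    omega
  rw [h3, Finset.card_empty, Nat.le_zero, Finset.card_eq_zero] at h2
  have h4 : (⟨1, by omega⟩ : Fin (2 * n)) ∈ (Finset.univ.filter
      fun i : Fin (2 * n) => (i : ℕ) % 2 = 1).filter (· ≤ (⟨1, by omega⟩ : Fin (2 * n))) := by
    simp
  rw [h2] at h4
  simp at h4

theorem coordVec_catalanMatroid_ne (hn : 2 ≤ n) :
    coordVec n (uniformSum (Nat.Partition.indiscrete n)) ≠ coordVec n (catalanMatroid n) := by
  intro h
  have hrefl : ∀ M : Matroid (Fin (2 * n)), Iso M M := fun M =>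
    ⟨Equiv.refl _, Matroid.ext_isBase (by simp) fun B _ => by simp⟩
  have hcard : (Finset.univ.filter fun i : Fin (2 * n) => n ≤ (i : ℕ)).card = n := by
    have := isMatroidOfRank_uniformSum (Nat.Partition.indiscrete n)
    rw [uniformSum_indiscrete_eq (by omega)] at this
    exact card_eq_of_isBase this (isBase_schubertMatroid.2 (GaleLE.refl _))
  have h1 := iso_of_coordVec_eq (k := n)
    ⟨catalanMatroid n, _, card_odd n, hrefl _⟩
    ⟨uniformSum (Nat.Partition.indiscrete n), _, hcard, by
      rw [uniformSum_indiscrete_eq (by omega)]; exact hrefl _⟩ h.symm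
  exact not_iso_catalanMatroid hn h1

end MatroidPolytopes

/-! ### The main theorem -/

open MatroidPolytopes
theorem theorem1 (n : ℕ) (hn : 1 ≤ n) :
    -- every matroid of rank `n` on `[2n]` has a unique Schubert expansion
    (∀ M : Matroid (Fin (2 * n)), IsMatroidOfRank n M →
      ∃! c : LabeledSchubert n (2 * n) →₀ ℤ, IsSchubertExpansion M c) ∧
    -- the Catalan matroid and the matroids `U_λ` are matroids of rank `n` on `[2n]`
    IsMatroidOfRank n (catalanMatroid n) ∧
    (∀ p : n.Partition, IsMatroidOfRank n (uniformSum p)) ∧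
    -- the Catalan matroid is not extremal
    (2 ≤ n → ¬ IsExtremal n (catalanMatroid n)) ∧
    -- its coordinate vector is a strictly positive convex combination of those of the `U_λ`
    (∀ p : n.Partition, 0 < (1 : ℝ) / zPart p) ∧
    ∑ p : n.Partition, (1 : ℝ) / zPart p = 1 ∧
    coordVec n (catalanMatroid n) =
      ∑ p : n.Partition, ((1 : ℝ) / zPart p) • coordVec n (uniformSum p) ∧
    -- and lies in the relative interior of their convex hull
    coordVec n (catalanMatroid n) ∈ intrinsicInterior ℝ
      (convexHull ℝ (Set.range fun p : n.Partition => coordVec n (uniformSum p))) := by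
  have hpos : ∀ p : n.Partition, 0 < (1 : ℝ) / zPart p := fun p =>
    one_div_pos.2 (by exact_mod_cast zPart_pos p)
  refine ⟨fun M hM => existsUnique_isSchubertExpansion hM, isMatroidOfRank_catalanMatroid n,
    isMatroidOfRank_uniformSum, fun hn2 hext => ?_, hpos, sum_one_div_zPart hn,
    coordVec_catalanMatroid hn, ?_⟩
  · unfold IsExtremal at hext
    rw [coordVec_catalanMatroid hn] at hext
    have := eq_of_mem_extremePoints_of_sum (convex_convexHull ℝ _)
      (fun p : n.Partition => coordVec n (uniformSum p)) (fun p => 1 / (zPart p : ℝ)) hpos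
      (sum_one_div_zPart hn)
      (fun p => subset_convexHull ℝ _
        (Set.mem_ofPred_eq ▸ ⟨uniformSum p, isMatroidOfRank_uniformSum p, rfl⟩)) hext
      (Nat.Partition.indiscrete n)
    rw [← coordVec_catalanMatroid hn] at this
    exact coordVec_catalanMatroid_ne hn2 this
  · have := Fintype.ofFinite (SchubertClass n (2 * n))
    rw [coordVec_catalanMatroid hn]
    exact sum_smul_mem_intrinsicInterior (fun p : n.Partition => coordVec n (uniformSum p)) _ hpos
      (sum_one_div_zPart hn)
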